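/- **Setting.** Let $e\ge 1$ be an integer. Choose a prime $\ell$ with $e\mid \ell-1$, a power $\ell^a$ ($a\ge 1$), a subgroup $E\le(\mathbb Z/\ell^a)^\times$ of order $e$, and a field $k$ of characteristic $\ell$, and put $G=\mathbb Z/\ell^a\rtimes E$. The simple $kG$-modules are the one-dimensional modules $T_1,\dots,T_e$, where $(z,g)$ acts on $T_i$ by $(g \bmod \ell)^{i-1}$; thus $T_1$ is trivial and the first $e$ radical layers of its projective cover are $T_1,\dots,T_e$, from the top down. A *perversity function* is a map $\pi:\{1,\dots,e\}\to\mathbb Z_{\ge0}$. *The algorithm* attaches to $\pi$ and $T_i$ a complex $X_i=X_i(\pi)$ of $kG$-modules in degrees $-n,\dots,0$, where $n=\pi(i)$. If $n=0$, it is $T_i$ in degree $0$. If $n>0$, put $L_{n+1}=T_i$ and, for $j=n,n-1,\dots,1$, let $P_j$ be the injective hull of $L_{j+1}$, let $M_j\subseteq P_j$ be the largest submodule containing $L_{j+1}$ such that every composition factor of $M_j/L_{j+1}$ is a $T_\alpha$ with $\pi(\alpha)<j$, and let $L_j=P_j/M_j$; then $$X_i=(P_n\to P_{n-1}\to\cdots\to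 P_1\to L_1),$$ with differentials $P_j\to L_j\hookrightarrow P_{j-1}$ and with $L_1$ in degree $0$. The *cohomology* of $X_i$ gives rise to - the *alternating sum of cohomology* $H_\pi(T_i)=\sum_{j=0}^{n}(-1)^{n-j}[H^{-j}(X_i)]=\sum_x h_\pi(i,x)\,[T_x]$ in the Grothendieck group; - the *Green correspondent*: the degree $0$ term $C_i$ of $X_i$; the *generic Green correspondent* is the pair $(c_{i,1},c_{i,2})$ such that $C_i$ has socle $T_{c_{i,1}}$ and top $T_{c_{i,2}}$. A subset $I\subseteq\{1,\dots,e\}$ is *cohomologically closed for $\pi$* if, whenever $x\in I$ and $T_x$ is a composition factor of $H^{-j}(X_i)$ for some $1\le j\le\pi(i)$, then $i\in I$. **Theorem.** Let $\pi$ be a perversity function and let $I_1\subseteq I=\{x_1<\dots<x_m\}$ be cohomologically closed for $\pi$ (for one choice of $\ell,a,E,k$). Let $\rho\in\mathrm{Sym}(e)$ fix every $i\notin I$ and satisfy $\rho(x_r)=x_{r+1}$, indices modulo $m$. Define $\pi'$ by $\pi'(i)=\pi(i)$ for $i\notin I$ and $\pi'(\rho(i))=\pi(i)+2$ for $i\in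 I$. Then, for all choices of $\ell,a,E,k$ (possibly different ones for $\pi$ and for $\pi'$): 1. $\pi$ and $\pi'$ are algorithmically equivalent via $\rho$: for each $i$ the complexes $X_i(\pi)$ and $X_{\rho(i)}(\pi')$ exist, $\pi(i)\equiv\pi'(\rho(i))\pmod 2$, their alternating sums of cohomology agree after relabelling by $\rho$, that is $h_\pi(i,x)=h_{\pi'}(\rho(i),\rho(x))$ for all $x$, and $T_i$ under $\pi$ and $T_{\rho(i)}$ under $\pi'$ have the same generic Green correspondent. 2. $I$ and $\rho(I_1)$ are cohomologically closed for $\pi'$. 3. (Version for a bijection of simple modules.) Take the same $\ell,a,E,k$ for $\pi$ and $\pi'$. Let $\sigma\in\mathrm{Sym}(e)$ and let $C_1,\dots,C_e$ be $kG$-modules such that, for every $s$, the degree $0$ term of $X_{\sigma(s)}(\pi)$ is isomorphic to $C_s$. Then, for every $s$, the degree $0$ term of $X_{\rho(\sigma(s))}(\pi')$ is isomorphic to $C_s$. -/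

import Mathlib

universe u

namespace PerverseAlgorithm

open CategoryTheory

/-! ## Composition factors, socle and top -/

section Modules

variable {A : Type u} [Ring A]

/-- For submodules `N₁ ≤ N₂` of `M`, the quotient `N₂ / N₁` is isomorphic to `T`. -/
def QuotIso {M : Type u} [AddCommGroup M] [Module A M] (N₁ N₂ : Submodule A M)
    (T : ModuleCat.{u} A) : Prop :=
  Nonempty ((N₂ ⧸ N₁.submoduleOf N₂) ≃ₗ[A] T)

/-- The simple module `T` occurs as a composition factor of `M`. -/
def IsCompositionFactor (T : ModuleCat.{u} A) (M : Type u) [AddCommGroup M] [Module A M] : Prop :=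
  ∃ N₁ N₂ : Submodule A M, N₁ ⋖ N₂ ∧ QuotIso N₁ N₂ T

/-- Every composition factor of `M` is one of the modules `T α` with `α ∈ S`. -/
def FactorsIn {ι : Type} (T : ι → ModuleCat.{u} A) (S : Set ι)
    (M : Type u) [AddCommGroup M] [Module A M] : Prop :=
  ∀ N₁ N₂ : Submodule A M, N₁ ⋖ N₂ → ∃ α ∈ S, QuotIso N₁ N₂ (T α)

/-- The number of factors isomorphic to `T` in a composition series. -/
noncomputable def seriesCount {M : Type u} [AddCommGroup M] [Module A M]
    (T : ModuleCat.{u} A) (s : CompositionSeries (Submodule A M)) : ℕ :=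
  Nat.card {i : Fin s.length // QuotIso (s i.castSucc) (s i.succ) T}

/-- The multiplicity of the simple module `T` as a composition factor of the module `M` of finite
length.  By `multiplicity_eq` any composition series from `⊥` to `⊤` computes it. -/
noncomputable def multiplicity (T : ModuleCat.{u} A)
    (M : Type u) [AddCommGroup M] [Module A M] : ℕ :=
  sSup {n | ∃ s : CompositionSeries (Submodule A M), s.head = ⊥ ∧ s.last = ⊤ ∧ n = seriesCount T s}

theorem seriesCount_eq {M : Type u} [AddCommGroup M] [Module A M] (T : ModuleCat.{u} A)
    (s t : CompositionSeries (Submodule A M)) (h : s.head = t.head) (h' : s.last = t.last) :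
    seriesCount T s = seriesCount T t := by
  obtain ⟨f, hf⟩ := CompositionSeries.jordan_holder s t h h'
  refine Nat.card_congr (f.subtypeEquiv fun i => ?_)
  obtain ⟨g⟩ := JordanHolderLattice.Iso.rel
    (fun a b : Submodule A M × Submodule A M =>
      Nonempty ((a.2 ⧸ a.1.submoduleOf a.2) ≃ₗ[A] (b.2 ⧸ b.1.submoduleOf b.2)))
    ⟨LinearEquiv.refl _ _⟩ (fun ⟨g⟩ => ⟨g.symm⟩) (fun ⟨g⟩ ⟨g'⟩ => ⟨g.trans g'⟩)
    (fun {x y} _ => by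
      rw [sup_comm, inf_comm]
      exact ⟨(LinearMap.quotientInfEquivSupQuotient y x).symm⟩) (hf i)
  exact ⟨fun ⟨k⟩ => ⟨g.symm.trans k⟩, fun ⟨k⟩ => ⟨g.trans k⟩⟩

theorem multiplicity_eq {M : Type u} [AddCommGroup M] [Module A M] (T : ModuleCat.{u} A)
    (s : CompositionSeries (Submodule A M)) (h : s.head = ⊥) (h' : s.last = ⊤) :
    multiplicity T M = seriesCount T s := by
  have : {n | ∃ t : CompositionSeries (Submodule A M),
      t.head = ⊥ ∧ t.last = ⊤ ∧ n = seriesCount T t} = {seriesCount T s} := by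
    ext n
    constructor
    · rintro ⟨t, ht, ht', rfl⟩
      exact seriesCount_eq T t s (ht.trans h.symm) (ht'.trans h'.symm)
    · rintro rfl
      exact ⟨s, h, h', rfl⟩
  rw [multiplicity, this, csSup_singleton]

/-- The socle: the sum of all simple submodules. -/
def socle (A : Type u) [Ring A] (M : Type u) [AddCommGroup M] [Module A M] : Submodule A M :=
  sSup {N | IsAtom N}

/-- `B` is an essential submodule. -/
def IsEssential {M : Type u} [AddCommGroup M] [Module A M] (B : Submodule A M) : Prop :=
  ∀ N : Submodule A M, N ⊓ B = ⊥ → N = ⊥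

end Modules

/-! ## The algorithm -/

section Algorithm

variable {A : Type u} [Ring A] {ι : Type}

/-- One step of the algorithm, in cohomological degree `-j`, where `B` is the image of what comes
before: the term `P_j` is an injective hull of `B`, and the kernel `M_j` of the outgoing
differential is the largest submodule of `P_j` containing `B` for which all composition factors
of `M_j / B` are of the form `T α` with `π α < j`. -/
structure IsStep (T : ι → ModuleCat.{u} A) (π : ι → ℕ) (X : ChainComplex (ModuleCat.{u} A) ℕ)
    (j : ℕ) (B : Submodule A (X.X j)) : Prop where
  injective : Injective (X.X j)
  essential : IsEssential B
  ker_isGreatest : IsGreatest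
    {M : Submodule A (X.X j) | B ≤ M ∧ FactorsIn T {α | π α < j} (M ⧸ B.submoduleOf M)}
    (LinearMap.ker (X.d j (j - 1)).hom)

/-- `X` is the complex `X_i` that the algorithm (with no relatively projective modules) attaches
to the simple module `T i` and the perversity function `π`.  Chain degree `j` is cohomological
degree `-j`.

The complex lives in degrees `-π i, …, 0`.  If `π i = 0` it is `T i` in degree `0`. Otherwise its
term in degree `-π i` is an injective hull of `T i`; its term in degree `-j`, for `0 < j < π i`, is
an injective hull of the image `L_{j+1}` of the incoming differential; the kernels are as in
`IsStep`; and the term in degree `0` is the image of the last differential. -/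
structure IsOutput (T : ι → ModuleCat.{u} A) (π : ι → ℕ) (i : ι)
    (X : ChainComplex (ModuleCat.{u} A) ℕ) : Prop where
  isZero : ∀ j, π i < j → Limits.IsZero (X.X j)
  of_eq_zero : π i = 0 → Nonempty (X.X 0 ≅ T i)
  first : 0 < π i → ∃ S : Submodule A (X.X (π i)), Nonempty (S ≃ₗ[A] T i) ∧ IsStep T π X (π i) S
  next : ∀ j, 0 < j → j < π i → IsStep T π X j (LinearMap.range (X.d (j + 1) j).hom)
  last : 0 < π i → Function.Surjective (X.d 1 0).hom

/-- The coefficient of `T x` in the alternating sum of cohomology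
`∑_{0 ≤ j ≤ π i} (-1)^(π i - j) [H^{-j}(X)]`. -/
noncomputable def altSum (T : ι → ModuleCat.{u} A) (π : ι → ℕ) (i : ι)
    (X : ChainComplex (ModuleCat.{u} A) ℕ) (x : ι) : ℤ :=
  ∑ j ∈ Finset.range (π i + 1), (-1) ^ (π i - j) * (multiplicity (T x) (X.homology j) : ℤ)

/-- The module `C` has socle `T c₁` and top `T c₂`. -/
def HasSocleTop (T : ι → ModuleCat.{u} A) (C : ModuleCat.{u} A) (c₁ c₂ : ι) : Prop :=
  Nonempty (socle A C ≃ₗ[A] T c₁) ∧ Nonempty ((C ⧸ Module.jacobson A C) ≃ₗ[A] T c₂)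

end Algorithm

/-! ## The groups `Z_{ℓ^a} ⋊ E` -/

/-- The choices made when the algorithm is applied to the cyclic group of order `e`: a prime `ℓ`
with `e ∣ ℓ - 1`, a power `ℓ ^ a` with `a > 0`, the group of order `e` acting faithfully
on `ℤ/ℓ^a`, and a field of characteristic `ℓ`. -/
structure Datum (e : ℕ) : Type (u + 1) where
  k : Type u
  [field : Field k]
  ℓ : ℕ
  [prime : Fact ℓ.Prime]
  [charP : CharP k ℓ]
  e_dvd : e ∣ ℓ - 1
  a : ℕ
  a_pos : 0 < a
  E : Subgroup (ZMod (ℓ ^ a))ˣ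
  card_E : Nat.card E = e

namespace Datum

attribute [instance] Datum.field Datum.prime Datum.charP

variable {e : ℕ} (D : Datum.{u} e)

/-- The action of `E` on the cyclic group of order `ℓ ^ a`. -/
def action : D.E →* MulAut (Multiplicative (ZMod (D.ℓ ^ D.a))) :=
  (MulAutMultiplicative (ZMod (D.ℓ ^ D.a))).symm.toMonoidHom.comp
    (DistribMulAction.toAddAut D.E (ZMod (D.ℓ ^ D.a)))

/-- The group `G = Z_{ℓ^a} ⋊ E`. -/
abbrev G : Type := Multiplicative (ZMod (D.ℓ ^ D.a)) ⋊[D.action] D.E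

/-- The group algebra `kG`. -/
abbrev Alg : Type u := MonoidAlgebra D.k D.G

/-- The reduction map `ℤ/ℓ^a → k`. -/
def reduction : ZMod (D.ℓ ^ D.a) →+* D.k :=
  ZMod.castHom (dvd_pow_self D.ℓ D.a_pos.ne') D.k

/-- The linear character `G → E → k`, `(z, g) ↦ (g mod ℓ) ^ i`. -/
def character (i : ℕ) : D.G →* D.k :=
  (powMonoidHom i).comp
    ((D.reduction : ZMod (D.ℓ ^ D.a) →* D.k).comp
      ((Units.coeHom (ZMod (D.ℓ ^ D.a))).comp
        (D.E.subtype.comp SemidirectProduct.rightHom)))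

/-- The simple `kG`-modules in their standard order: `T i` is the one-dimensional module with
character `(z, g) ↦ (g mod ℓ) ^ i`, `0 ≤ i < e`.  The first one is trivial.  If `x` generates
`Z_{ℓ^a}`, then `g (x - 1) g⁻¹ = x ^ g - 1 ≡ g (x - 1)` modulo the square of the augmentation
ideal of `kZ_{ℓ^a}`, so the first `e` radical layers of the projective cover `k[G/E]` of
the trivial module are `T 0, T 1, …, T (e - 1)`, from the top downwards. -/
noncomputable def T (i : Fin e) : ModuleCat.{u} D.Alg :=
  (ModuleCat.restrictScalars
    (MonoidAlgebra.lift D.k D.k D.G (D.character i)).toRingHom).obj (ModuleCat.of D.k D.k)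

/-- `X` is the complex attached to `T i` when the algorithm is applied to `(kG, π)`. -/
def Output (π : Fin e → ℕ) (i : Fin e) (X : ChainComplex (ModuleCat.{u} D.Alg) ℕ) : Prop :=
  IsOutput D.T π i X

/-- `I` is cohomologically closed for `π`: if `T x`, with `x ∈ I`, occurs in the cohomology of
the complex attached to `T i`, then `i ∈ I`. -/
def CohomologicallyClosed (π : Fin e → ℕ) (I : Finset (Fin e)) : Prop :=
  ∀ (i : Fin e) (X : ChainComplex (ModuleCat.{u} D.Alg) ℕ), D.Output π i X →
    ∀ j, 1 ≤ j → j ≤ π i → ∀ x ∈ I, IsCompositionFactor (D.T x) (X.homology j) → i ∈ I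

/-- The modules `C s` are the degree `0` terms of the complexes that the algorithm with perversity
function `π` attaches to the simple modules `T (σ s)`. -/
def DegreeZeroTerms (π : Fin e → ℕ) (σ : Equiv.Perm (Fin e))
    (C : Fin e → ModuleCat.{u} D.Alg) : Prop :=
  ∀ s, ∃ X, D.Output π (σ s) X ∧ Nonempty (X.X 0 ≅ C s)

end Datum

/-- `π` and `π'` are algorithmically equivalent via `ρ`, where the algorithm is applied to `π` with
the choices `D` and to `π'` with the choices `D'`.  For each `i`, the complexes `X` of `T i` for
`π` and `X'` of `T (ρ i)` for `π'` exist; their alternating sums of cohomology agree when `T x`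
(for `π`) is identified with `T (ρ x)` (for `π'`); their degree `0` terms have the same socle
and the same top; and `π i` and `π' (ρ i)` have the same parity. -/
def AlgorithmicallyEquivalentVia {e : ℕ} (D D' : Datum.{u} e) (π π' : Fin e → ℕ)
    (ρ : Equiv.Perm (Fin e)) : Prop :=
  ∀ i, π i ≡ π' (ρ i) [MOD 2] ∧ (∃ X, D.Output π i X) ∧ (∃ X', D'.Output π' (ρ i) X') ∧
    ∀ X X', D.Output π i X → D'.Output π' (ρ i) X' →
      (∀ x, altSum D.T π i X x = altSum D'.T π' (ρ i) X' (ρ x)) ∧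
      ∃ c₁ c₂, HasSocleTop D.T (X.X 0) c₁ c₂ ∧ HasSocleTop D'.T (X'.X 0) c₁ c₂

/-- For `I = {x_1 < ⋯ < x_m}`, the permutation with `x_r ↦ x_{r+1}` (and `x_m ↦ x_1`) that fixes
everything outside `I`. -/
def cyclePerm {e : ℕ} (I : Finset (Fin e)) : Equiv.Perm (Fin e) :=
  Equiv.Perm.ofSubtype (p := fun x => x ∈ I)
    ((I.orderIsoOfFin rfl).toEquiv.permCongr (finRotate I.card))

end PerverseAlgorithm

/-! Every indecomposable injective `kG`-module is uniserial of length q = ℓ^a, with factors labelled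
c, c - 1, c - 2, … modulo e from the socle upwards (`isUniserial_coind`, `injective_coind`). A
uniserial module is thus determined by its socle label and its length, and the algorithm can be
followed on the integer line, the universal cover of the cycle of labels. Let p j be the position of
the socle of L_j. As q ≡ 1 modulo e, the top of L_j has the label of p (j + 1). So the factors of
P_j above L_{j+1} are labelled p (j + 2) - 1, p (j + 2) - 2, …, and M_j absorbs them until one of
perversity at least j appears. Hence p j is the greatest position below p (j + 2) of perversity at
least j (`IsWalk`). The cohomology in degree -j consists of the positions skipped, together with T_i
itself if j = π i, and C_i has socle p 1 and top p 2. None of this depends on ℓ, a, E or k.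

Let S be the set of positions with label in I; on S the permutation ρ is the passage to the next
element. Closedness says that a walk skipping an element of S starts in S. It follows that P is
bounded by P f on the gap of S above f (`le_of_notMem`), and that walks starting off S do not change
(`isWalk_of_notMem`). For w in S with successor w', the old walk p from w and the new walk p' from
w' stay linked: strictly between p j and p' (j + 2) there is neither an element of S nor a position
of perversity at least j (`Rel`, propagated downwards by `rel_step`). Since P' is at least 2 on S,
the walks agree at 1 and 2, which gives the same Green correspondents.

For a label in I, skipped positions correspond one to one under the successor map, two degrees apart
(`passes_forward`, `passes_backward`). For a label outside I only the alternating sums agree, by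
telescoping (`walkSum_of_disjoint`). -/

namespace PerverseAlgorithm

open CategoryTheory

/-! ### Uniserial modules. -/

section Uniserial

variable {A : Type u} [Ring A] {ι : Type}

/-- `M` is uniserial of length `r` with submodules `N 0 < N 1 < ⋯ < N r`, and its composition
factors, from the socle upwards, are labelled `c, c - 1, …, c - r + 1`. -/
structure IsUniserial (T : ι → ModuleCat.{u} A) (lab : ℤ → ι) (M : Type u) [AddCommGroup M]
    [Module A M] (c : ℤ) (r : ℕ) (N : ℕ → Submodule A M) : Prop where
  bot : N 0 = ⊥
  top : N r = ⊤
  lt : ∀ s < r, N s < N (s + 1)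
  factor : ∀ s < r, QuotIso (N s) (N (s + 1)) (T (lab (c - s)))
  exists_eq : ∀ W : Submodule A M, ∃ s ≤ r, W = N s

theorem quotient_equiv_of_map {M M' : Type u} [AddCommGroup M] [Module A M] [AddCommGroup M']
    [Module A M'] (f : M →ₗ[A] M') {A₁ A₂ : Submodule A M} {B₁ B₂ : Submodule A M'}
    (h : A₂.map f = B₂) (hk : ∀ x ∈ A₂, f x ∈ B₁ ↔ x ∈ A₁) :
    Nonempty ((A₂ ⧸ A₁.submoduleOf A₂) ≃ₗ[A] (B₂ ⧸ B₁.submoduleOf B₂)) := by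
  subst h
  let g : A₂ →ₗ[A] A₂.map f := (f.domRestrict A₂).codRestrict _ fun x => ⟨x, x.2, rfl⟩
  let φ := (B₁.submoduleOf (A₂.map f)).mkQ.comp g
  have hφ : Function.Surjective φ := by
    refine (Submodule.mkQ_surjective _).comp ?_
    rintro ⟨_, x, hx, rfl⟩
    exact ⟨⟨x, hx⟩, rfl⟩
  have hker : LinearMap.ker φ = A₁.submoduleOf A₂ := by
    ext x
    change Submodule.Quotient.mk (g x) = 0 ↔ _
    rw [Submodule.Quotient.mk_eq_zero]
    exact hk x x.2
  exact ⟨(Submodule.quotEquivOfEq _ _ hker.symm).trans (φ.quotKerEquivOfSurjective hφ)⟩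

namespace IsUniserial

variable {T : ι → ModuleCat.{u} A} {lab : ℤ → ι} {M M' : Type u} [AddCommGroup M] [Module A M]
  [AddCommGroup M'] [Module A M'] {c : ℤ} {r : ℕ} {N : ℕ → Submodule A M}

theorem congr_label (h : IsUniserial T lab M c r N) {c' : ℤ}
    (hc : ∀ s : ℕ, lab (c - s) = lab (c' - s)) : IsUniserial T lab M c' r N :=
  { h with factor := fun s hs => hc s ▸ h.factor s hs }

theorem strictMono (h : IsUniserial T lab M c r N) {s t : ℕ} (hst : s < t) (ht : t ≤ r) :
    N s < N t := by
  induction t, hst using Nat.le_induction with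
  | base => exact h.lt s ht
  | succ t hst ih => exact (ih (by omega)).trans (h.lt t ht)

theorem mono (h : IsUniserial T lab M c r N) {s t : ℕ} (hst : s ≤ t) (ht : t ≤ r) : N s ≤ N t := by
  rcases hst.eq_or_lt with rfl | hlt
  · exact le_rfl
  · exact (h.strictMono hlt ht).le

theorem le_iff (h : IsUniserial T lab M c r N) {s t : ℕ} (hs : s ≤ r) (ht : t ≤ r) :
    N s ≤ N t ↔ s ≤ t := by
  refine ⟨fun hle => ?_, fun hst => h.mono hst ht⟩
  by_contra! hlt
  exact (h.strictMono hlt hs).not_ge hle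

theorem inj (h : IsUniserial T lab M c r N) {s t : ℕ} (hs : s ≤ r) (ht : t ≤ r)
    (hst : N s = N t) : s = t :=
  le_antisymm ((h.le_iff hs ht).1 hst.le) ((h.le_iff ht hs).1 hst.ge)

theorem covBy_iff (h : IsUniserial T lab M c r N) {s t : ℕ} (hs : s ≤ r) (ht : t ≤ r) :
    N s ⋖ N t ↔ t = s + 1 := by
  constructor
  · intro hc
    have hst : s < t := by
      by_contra! hts
      exact hc.lt.not_ge (h.mono hts hs)
    by_contra hne
    exact hc.2 (h.strictMono (Nat.lt_succ_self s) (by omega))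
      (h.strictMono (show s + 1 < t by omega) ht)
  · rintro rfl
    refine ⟨h.lt s ht, fun W h₁ h₂ => ?_⟩
    obtain ⟨w, hw, rfl⟩ := h.exists_eq W
    have h₃ := (h.le_iff hw ht).1 h₂.le
    have h₄ := (h.le_iff hs hw).1 h₁.le
    rcases (show w = s ∨ w = s + 1 by omega) with rfl | rfl
    · exact h₁.ne rfl
    · exact h₂.ne rfl

theorem map (h : IsUniserial T lab M c r N) (f : M ≃ₗ[A] M') :
    IsUniserial T lab M' c r fun s => (N s).map (f : M →ₗ[A] M') where
  bot := by rw [h.bot, Submodule.map_bot]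
  top := by rw [h.top, Submodule.map_top, LinearEquiv.range]
  lt s hs := Submodule.map_strictMono_of_injective f.injective (h.lt s hs)
  factor s hs := by
    obtain ⟨g⟩ := h.factor s hs
    obtain ⟨g'⟩ := quotient_equiv_of_map (f : M →ₗ[A] M') (A₁ := N s) (A₂ := N (s + 1))
      (B₁ := (N s).map (f : M →ₗ[A] M')) rfl fun x _ => by
        simp
    exact ⟨g'.symm.trans g⟩
  exists_eq W := by
    obtain ⟨s, hs, hW⟩ := h.exists_eq (W.comap (f : M →ₗ[A] M'))
    exact ⟨s, hs, by rw [← hW, Submodule.map_comap_eq_of_surjective f.surjective]⟩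

theorem submodule (h : IsUniserial T lab M c r N) {v : ℕ} (hv : v ≤ r) :
    IsUniserial T lab (N v) c v fun s => (N s).submoduleOf (N v) where
  bot := by rw [h.bot]; simp [Submodule.submoduleOf]
  top := by simp [Submodule.submoduleOf]
  lt s hs := by
    have hlt := h.lt s (by omega)
    have hle := h.mono (show s + 1 ≤ v by omega) hv
    refine lt_of_le_of_ne (Submodule.comap_mono hlt.le) fun heq => hlt.not_ge fun x hx => ?_
    have : (⟨x, hle hx⟩ : N v) ∈ (N s).submoduleOf (N v) := by
      rw [heq]; exact hx
    exact this
  factor s hs := by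
    obtain ⟨g⟩ := h.factor s (by omega)
    have hle := h.mono (show s + 1 ≤ v by omega) hv
    obtain ⟨g'⟩ := quotient_equiv_of_map (N v).subtype (A₁ := (N s).submoduleOf (N v))
      (A₂ := (N (s + 1)).submoduleOf (N v)) (B₁ := N s) (B₂ := N (s + 1))
      (by simpa [Submodule.submoduleOf, Submodule.map_comap_subtype] using hle)
      fun x _ => Iff.rfl
    exact ⟨g'.trans g⟩
  exists_eq W := by
    obtain ⟨s, hs, hW⟩ := h.exists_eq (W.map (N v).subtype)
    have hle : N s ≤ N v := hW ▸ Submodule.map_subtype_le _ _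
    refine ⟨s, (h.le_iff hs hv).1 hle, ?_⟩
    rw [← hW, Submodule.submoduleOf,
      Submodule.comap_map_eq_of_injective (Submodule.injective_subtype _)]

theorem quotient (h : IsUniserial T lab M c r N) {v : ℕ} (hv : v ≤ r) :
    IsUniserial T lab (M ⧸ N v) (c - v) (r - v) fun s => (N (v + s)).map (N v).mkQ where
  bot := by simp
  top := by rw [Nat.add_sub_cancel' hv, h.top, Submodule.map_top, Submodule.range_mkQ]
  lt s hs := by
    have hlt := h.lt (v + s) (by omega)
    have hle := h.mono (show v ≤ v + s by omega) (by omega)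
    refine lt_of_le_of_ne (Submodule.map_mono hlt.le) fun heq => hlt.ne ?_
    have := congrArg (Submodule.comap (N v).mkQ) heq
    rwa [Submodule.comap_map_mkQ, Submodule.comap_map_mkQ, sup_eq_right.2 hle,
      ← add_assoc, sup_eq_right.2 (hle.trans hlt.le)] at this
  factor s hs := by
    obtain ⟨g⟩ := h.factor (v + s) (by omega)
    have hle := h.mono (show v ≤ v + s by omega) (by omega)
    obtain ⟨g'⟩ := quotient_equiv_of_map (N v).mkQ (A₁ := N (v + s)) (A₂ := N (v + s + 1))
      (B₁ := (N (v + s)).map (N v).mkQ) rfl fun x _ => by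
        rw [← Submodule.mem_comap, Submodule.comap_map_mkQ, sup_eq_right.2 hle]
    have hl : c - ((v + s : ℕ) : ℤ) = c - v - s := by push_cast; ring
    rw [hl] at g
    exact ⟨g'.symm.trans g⟩
  exists_eq W := by
    obtain ⟨s, hs, hW⟩ := h.exists_eq (W.comap (N v).mkQ)
    have hle : N v ≤ N s := by
      rw [← hW]; exact Submodule.le_comap_mkQ _ _
    have hvs := (h.le_iff hv hs).1 hle
    refine ⟨s - v, by omega, ?_⟩
    rw [Nat.add_sub_cancel' hvs, ← hW,
      Submodule.map_comap_eq_of_surjective (Submodule.mkQ_surjective _)]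

theorem subquotient (h : IsUniserial T lab M c r N) {v w : ℕ} (hvw : v ≤ w) (hw : w ≤ r) :
    ∃ N', IsUniserial T lab (N w ⧸ (N v).submoduleOf (N w)) (c - v) (w - v) N' :=
  ⟨_, (h.submodule hw).quotient hvw⟩

/-- The number of submodules is r + 1. -/
theorem length_unique (h : IsUniserial T lab M c r N) {c' : ℤ} {r' : ℕ} {N' : ℕ → Submodule A M}
    (h' : IsUniserial T lab M c' r' N') : r = r' := by
  have key : ∀ {c : ℤ} {r : ℕ} {N : ℕ → Submodule A M}, IsUniserial T lab M c r N →
      Nat.card (Submodule A M) = r + 1 := by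
    intro c r N h
    have : Function.Bijective fun s : Fin (r + 1) => N s := by
      refine ⟨fun s t hst => Fin.ext (h.inj (by omega) (by omega) hst), fun W => ?_⟩
      obtain ⟨s, hs, rfl⟩ := h.exists_eq W
      exact ⟨⟨s, by omega⟩, rfl⟩
    rw [← Nat.card_eq_of_bijective _ this, Nat.card_fin]
  have := (key h).symm.trans (key h')
  omega

/-- A nonzero submodule contains the socle `N 1`, so injectivity can be tested there. -/
theorem ker_eq_bot (h : IsUniserial T lab M c r N) (f : M →ₗ[A] M')
    (hf : ∀ x ∈ N 1, f x = 0 → x = 0) : LinearMap.ker f = ⊥ := by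
  obtain ⟨s, hs, hk⟩ := h.exists_eq (LinearMap.ker f)
  rcases Nat.eq_zero_or_pos s with rfl | hpos
  · rw [hk, h.bot]
  · exfalso
    have h1 : N 1 ≤ LinearMap.ker f := hk ▸ h.mono hpos hs
    have h2 : N 1 = ⊥ := by
      rw [eq_bot_iff]
      intro x hx
      exact hf x hx (h1 hx)
    exact (h.strictMono Nat.zero_lt_one (by omega)).ne (by rw [h2, h.bot])

theorem equiv_one (h : IsUniserial T lab M c r N) (hr : 0 < r) :
    Nonempty (N 1 ≃ₗ[A] T (lab c)) := by
  obtain ⟨g⟩ := h.factor 0 hr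
  rw [Nat.cast_zero, sub_zero] at g
  have : (N 0).submoduleOf (N 1) = ⊥ := by
    rw [h.bot]; simp [Submodule.submoduleOf]
  exact ⟨(Submodule.quotEquivOfEqBot _ this).symm.trans g⟩

/-! ### Composition factors of a uniserial module. -/

section Count

variable (hT : ∀ i j, Nonempty (T i ≃ₗ[A] T j) → i = j)
include hT

theorem quotIso_iff (h : IsUniserial T lab M c r N) {s : ℕ} (hs : s < r) {x : ι} :
    QuotIso (N s) (N (s + 1)) (T x) ↔ lab (c - s) = x := by
  constructor
  · rintro ⟨g⟩
    obtain ⟨g'⟩ := h.factor s hs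
    exact hT _ _ ⟨g'.symm.trans g⟩
  · rintro rfl
    exact h.factor s hs

theorem isCompositionFactor_iff (h : IsUniserial T lab M c r N) {x : ι} :
    IsCompositionFactor (T x) M ↔ ∃ s < r, lab (c - s) = x := by
  constructor
  · rintro ⟨N₁, N₂, hc, hq⟩
    obtain ⟨s, hs, rfl⟩ := h.exists_eq N₁
    obtain ⟨t, ht, rfl⟩ := h.exists_eq N₂
    obtain rfl := (h.covBy_iff hs ht).1 hc
    exact ⟨s, ht, (h.quotIso_iff hT ht).1 hq⟩
  · rintro ⟨s, hs, hx⟩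
    exact ⟨N s, N (s + 1), (h.covBy_iff hs.le hs).2 rfl, (h.quotIso_iff hT hs).2 hx⟩

theorem factorsIn_iff (h : IsUniserial T lab M c r N) {S : Set ι} :
    FactorsIn T S M ↔ ∀ s < r, lab (c - s) ∈ S := by
  constructor
  · intro hS s hs
    obtain ⟨α, hα, hq⟩ := hS _ _ ((h.covBy_iff hs.le hs).2 rfl)
    rwa [(h.quotIso_iff hT hs).1 hq]
  · intro hS N₁ N₂ hc
    obtain ⟨s, hs, rfl⟩ := h.exists_eq N₁
    obtain ⟨t, ht, rfl⟩ := h.exists_eq N₂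
    obtain rfl := (h.covBy_iff hs ht).1 hc
    exact ⟨_, hS s ht, h.factor s ht⟩

theorem multiplicity_eq_card [DecidableEq ι] (h : IsUniserial T lab M c r N) (x : ι) :
    multiplicity (T x) M = ((Finset.range r).filter fun s : ℕ => lab (c - s) = x).card := by
  let S : CompositionSeries (Submodule A M) :=
    { length := r
      toFun := fun i => N i
      step := fun i => (h.covBy_iff (by simp) (by simp)).2 (by simp) }
  rw [multiplicity_eq (T x) S (by simpa [S, RelSeries.head] using h.bot)
    (by simpa [S, RelSeries.last] using h.top), seriesCount,
    ← Nat.subtype_card (p := fun s : ℕ => s < r ∧ lab (c - s) = x) _ (by simp)]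
  exact Nat.card_congr ⟨fun i => ⟨i.1, i.1.2, (h.quotIso_iff hT i.1.2).1 i.2⟩,
    fun s => ⟨⟨s.1, s.2.1⟩, (h.quotIso_iff hT s.2.1).2 s.2.2⟩, fun _ => rfl, fun _ => rfl⟩

end Count

theorem socle_eq (h : IsUniserial T lab M c r N) (hr : 0 < r) : socle A M = N 1 := by
  refine le_antisymm (sSup_le fun W hW => ?_) (le_sSup ?_)
  · obtain ⟨s, hs, rfl⟩ := h.exists_eq W
    have := (h.covBy_iff (Nat.zero_le r) hs).1 (by rw [h.bot]; exact bot_covBy_iff.2 hW)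
    rw [this]
  · have := (h.covBy_iff (Nat.zero_le r) hr).2 rfl
    rw [h.bot] at this
    exact bot_covBy_iff.1 this

theorem jacobson_eq (h : IsUniserial T lab M c r N) (hr : 0 < r) :
    Module.jacobson A M = N (r - 1) := by
  refine le_antisymm (sInf_le ?_) (le_sInf fun W hW => ?_)
  · have := (h.covBy_iff (show r - 1 ≤ r by omega) le_rfl).2 (by omega)
    rw [h.top] at this
    exact covBy_top_iff.1 this
  · obtain ⟨s, hs, rfl⟩ := h.exists_eq W
    have := (h.covBy_iff hs le_rfl).1 (by rw [h.top]; exact covBy_top_iff.2 hW)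
    rw [this, Nat.add_sub_cancel]

theorem hasSocleTop {C : ModuleCat.{u} A} {N : ℕ → Submodule A C} (h : IsUniserial T lab C c r N)
    (hr : 0 < r) : HasSocleTop T C (lab c) (lab (c - r + 1)) := by
  constructor
  · rw [h.socle_eq hr]
    exact h.equiv_one hr
  · have hq := h.quotient (show r - 1 ≤ r by omega)
    obtain ⟨g⟩ := hq.equiv_one (by omega)
    have htop : (N (r - 1 + 1)).map (N (r - 1)).mkQ = ⊤ := by
      rw [Nat.sub_add_cancel hr, h.top, Submodule.map_top, Submodule.range_mkQ]
    have hc : c - ((r - 1 : ℕ) : ℤ) = c - r + 1 := by omega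
    rw [hc] at g
    exact ⟨(Submodule.quotEquivOfEq _ _ (h.jacobson_eq hr)).trans
      ((LinearEquiv.ofTop _ htop).symm.trans g)⟩

/-! ### Injective uniserial modules -/

section InjectiveHull

variable {P : Type u} [AddCommGroup P] [Module A P] [Module.Injective A P] {q : ℕ}
  {K : ℕ → Submodule A P}

/-- An isomorphism of the socles extends to `M` because `P` is injective, and the extension is
injective because it is so on the socle. -/
theorem exists_embedding (h : IsUniserial T lab M c r N) (hP : IsUniserial T lab P c q K)
    (hq : 0 < q) : ∃ f : M →ₗ[A] P, Function.Injective f := by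
  rcases Nat.eq_zero_or_pos r with rfl | hr
  · refine ⟨0, ?_⟩
    rw [← LinearMap.ker_eq_bot, LinearMap.ker_zero, ← h.top, h.bot]
  obtain ⟨g⟩ := h.equiv_one hr
  obtain ⟨g'⟩ := hP.equiv_one hq
  let φ : N 1 →ₗ[A] P := (K 1).subtype.comp (g.trans g'.symm).toLinearMap
  obtain ⟨f, hf⟩ := Module.Injective.out (N 1).subtype (Submodule.injective_subtype _) φ
  refine ⟨f, LinearMap.ker_eq_bot.1 (h.ker_eq_bot f fun x hx h0 => ?_)⟩
  have := hf ⟨x, hx⟩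
  rw [Submodule.subtype_apply] at this
  rw [this] at h0
  have h1 : (⟨x, hx⟩ : N 1) = 0 := by
    apply (g.trans g'.symm).injective
    apply Submodule.injective_subtype
    simpa [φ] using h0
  exact congrArg Subtype.val h1

/-- The image of an embedding is some `K s`, and comparing lengths gives s = r. Hence socle label
and length determine a uniserial module up to isomorphism. -/
theorem exists_equiv (h : IsUniserial T lab M c r N) (hP : IsUniserial T lab P c q K)
    (hq : 0 < q) : r ≤ q ∧ Nonempty (M ≃ₗ[A] K r) := by
  obtain ⟨f, hf⟩ := h.exists_embedding hP hq
  obtain ⟨s, hs, hK⟩ := hP.exists_eq (LinearMap.range f)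
  have e : M ≃ₗ[A] K s := (LinearEquiv.ofInjective f hf).trans (LinearEquiv.ofEq _ _ hK)
  obtain rfl := (h.map e).length_unique (hP.submodule hs)
  exact ⟨hs, ⟨e⟩⟩

theorem nonempty_equiv {N' : ℕ → Submodule A M'} (h : IsUniserial T lab M c r N)
    (h' : IsUniserial T lab M' c r N') (hP : IsUniserial T lab P c q K) (hq : 0 < q) :
    Nonempty (M ≃ₗ[A] M') := by
  obtain ⟨-, ⟨e⟩⟩ := h.exists_equiv hP hq
  obtain ⟨-, ⟨e'⟩⟩ := h'.exists_equiv hP hq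
  exact ⟨e.trans e'.symm⟩

/-- An injective module with an essential uniserial submodule is uniserial. -/
theorem of_essential {Q : Type u} [AddCommGroup Q] [Module A Q] [Module.Injective A Q]
    {B : Submodule A Q} (hB : IsEssential B) {N : ℕ → Submodule A B}
    (h : IsUniserial T lab B c r N) (hr : 0 < r) (hP : IsUniserial T lab P c q K)
    (hq : 0 < q) : ∃ K' : ℕ → Submodule A Q, IsUniserial T lab Q c q K' ∧ r ≤ q ∧ B = K' r := by
  obtain ⟨f, hf⟩ := h.exists_embedding hP hq
  obtain ⟨g, hg⟩ := Module.Injective.out f hf B.subtype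
  -- `B` is nonzero, so its image under `f` contains the socle `K 1` of `P`; on that image `g`
  -- inverts `f`.
  have hginj : LinearMap.ker g = ⊥ := by
    refine hP.ker_eq_bot g fun x hx h0 => ?_
    obtain ⟨s, hs, hK⟩ := hP.exists_eq (LinearMap.range f)
    have hspos : 0 < s := by
      by_contra! h0
      obtain rfl : s = 0 := by omega
      rw [hP.bot, LinearMap.range_eq_bot] at hK
      subst hK
      apply (h.strictMono hr le_rfl).ne
      ext y
      simp only [h.bot, h.top, Submodule.mem_bot, Submodule.mem_top, iff_true]
      exact hf rfl
    have : x ∈ LinearMap.range f := hK ▸ hP.mono hspos hs hx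
    obtain ⟨b, rfl⟩ := this
    have := hg b
    rw [h0] at this
    have hb : b = 0 := Subtype.ext this.symm
    rw [hb, map_zero]
  -- Injectivity of `P` yields a retraction `p` of `g`. Its kernel meets `B` trivially, so it
  -- vanishes as `B` is essential, and `p` is an isomorphism.
  obtain ⟨p, hp⟩ := Module.Injective.out g (LinearMap.ker_eq_bot.1 hginj) (LinearMap.id (M := P))
  have hpinj : LinearMap.ker p = ⊥ := by
    refine hB _ (eq_bot_iff.2 ?_)
    rintro b ⟨hb0, hb⟩
    have h1 := hp (f ⟨b, hb⟩)
    rw [hg] at h1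
    have h2 : f ⟨b, hb⟩ = 0 := h1.symm.trans hb0
    have h3 : (⟨b, hb⟩ : B) = 0 := hf (h2.trans (map_zero f).symm)
    exact congrArg Subtype.val h3
  let e : Q ≃ₗ[A] P := LinearEquiv.ofBijective p
    ⟨LinearMap.ker_eq_bot.1 hpinj, fun x => ⟨g x, hp x⟩⟩
  have hQ := hP.map e.symm
  obtain ⟨s, hs, hBs⟩ := hQ.exists_eq B
  have hlen := (h.map (LinearEquiv.ofEq _ _ hBs)).length_unique (hQ.submodule hs)
  subst hlen
  exact ⟨_, hQ, hs, hBs⟩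

end InjectiveHull

end IsUniserial

end Uniserial

/-! ### Labels of integer positions. -/

/-- The label in `Fin e` of a position on the integer line. -/
def residue (e : ℕ) [NeZero e] (z : ℤ) : Fin e :=
  ⟨(z % e).toNat, by
    have := Int.emod_lt_of_pos z (show (0 : ℤ) < e from mod_cast Nat.pos_of_neZero e)
    have := Int.emod_nonneg z (show (e : ℤ) ≠ 0 from mod_cast NeZero.ne e)
    omega⟩

theorem residue_val (e : ℕ) [NeZero e] (z : ℤ) : ((residue e z : ℕ) : ℤ) = z % e := by
  have := Int.emod_nonneg z (show (e : ℤ) ≠ 0 from mod_cast NeZero.ne e)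
  simp [residue, this]

theorem residue_eq_iff {e : ℕ} [NeZero e] {z w : ℤ} :
    residue e z = residue e w ↔ z % e = w % e := by
  rw [← residue_val, ← residue_val, Fin.ext_iff, Nat.cast_inj]

theorem residue_coe {e : ℕ} [NeZero e] (i : Fin e) : residue e ((i : ℕ) : ℤ) = i := by
  have : ((i : ℕ) : ℤ) % e = (i : ℕ) := Int.emod_eq_of_lt (by omega) (by have := i.2; omega)
  rw [Fin.ext_iff, ← Nat.cast_inj (R := ℤ), residue_val, this]

theorem monoidAlgebra_map_smul {k G V W : Type*} [Field k] [Group G] [AddCommGroup V]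
    [AddCommGroup W] [Module (MonoidAlgebra k G) V] [Module (MonoidAlgebra k G) W] (f : V →+ W)
    (h : ∀ (g : G) (t : k) (v : V),
      f (MonoidAlgebra.single g t • v) = MonoidAlgebra.single g t • f v)
    (a : MonoidAlgebra k G) (v : V) : f (a • v) = a • f v := by
  induction a using MonoidAlgebra.induction_linear with
  | zero => simp
  | add a b ha hb => rw [add_smul, map_add, ha, hb, add_smul]
  | single g t => exact h g t v

/-! ### The characters of E and the simple modules. -/

namespace Datum

variable {e : ℕ} (D : Datum.{u} e)

instance : NeZero (D.ℓ ^ D.a) := ⟨pow_ne_zero _ D.prime.out.ne_zero⟩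

/-- The length of the injective indecomposable modules. -/
abbrev q : ℕ := D.ℓ ^ D.a

theorem neZero (D : Datum.{u} e) : NeZero e :=
  ⟨fun h => (Nat.card_pos (α := D.E)).ne' (D.card_E.trans h)⟩

/-- The faithful character of `E`. -/
def chi : D.E →* D.k :=
  (D.reduction : ZMod (D.ℓ ^ D.a) →* D.k).comp
    ((Units.coeHom (ZMod (D.ℓ ^ D.a))).comp D.E.subtype)

theorem chi_apply (g : D.E) : D.chi g = D.reduction ((g : (ZMod D.q)ˣ) : ZMod D.q) := rfl

theorem character_apply (i : ℕ) (x : D.G) : D.character i x = D.chi (x.right ^ i) := by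
  rw [map_pow]; rfl

theorem reduction_apply (z : ZMod D.q) : D.reduction z = (z.val : D.k) := by
  conv_lhs => rw [← ZMod.natCast_zmod_val z]
  exact map_natCast _ _

theorem coprime_e : Nat.Coprime e D.ℓ := by
  have hp := D.prime.out
  refine ((Nat.Prime.coprime_iff_not_dvd hp).2 fun h => ?_).symm
  have h1 := Nat.le_of_dvd (by have := hp.two_le; omega) (h.trans D.e_dvd)
  have := hp.two_le
  omega

theorem natCast_e_ne_zero : (e : D.k) ≠ 0 := by
  rw [Ne, CharP.cast_eq_zero_iff D.k D.ℓ]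
  intro h
  have := Nat.Coprime.eq_one_of_dvd D.coprime_e.symm h
  exact D.prime.out.one_lt.ne' this

theorem pow_card (g : D.E) : g ^ e = 1 := by
  have := pow_card_eq_one' (x := g)
  rwa [D.card_E] at this

/-- A unit congruent to 1 modulo ℓ has order dividing ℓ^(a - 1), while its order as an element of E
divides e, which is prime to ℓ. -/
theorem chi_injective : Function.Injective D.chi := by
  rw [injective_iff_map_eq_one]
  intro g hg
  have h1 : (D.ℓ : ℤ) ∣ (((g : (ZMod D.q)ˣ) : ZMod D.q).val : ℤ) - 1 := by
    rw [← CharP.intCast_eq_zero_iff D.k D.ℓ]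
    push_cast
    rw [← reduction_apply, ← chi_apply, hg, sub_self]
  obtain ⟨b, hb⟩ := Nat.exists_eq_succ_of_ne_zero D.a_pos.ne'
  have h2 : g ^ D.ℓ ^ b = 1 := by
    have h3 := dvd_sub_pow_of_dvd_sub h1 b
    rw [one_pow] at h3
    have h4 : ((D.q : ℕ) : ℤ) ∣ (((g : (ZMod D.q)ˣ) : ZMod D.q).val : ℤ) ^ D.ℓ ^ b - 1 := by
      have hq : ((D.q : ℕ) : ℤ) = (D.ℓ : ℤ) ^ (b + 1) := by rw [q, hb]; push_cast; rfl
      rw [hq]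
      exact h3
    rw [← ZMod.intCast_zmod_eq_zero_iff_dvd] at h4
    push_cast at h4
    rw [ZMod.natCast_zmod_val, sub_eq_zero] at h4
    ext
    simpa using h4
  have h3 : orderOf g ∣ 1 := by
    have hc : Nat.Coprime e (D.ℓ ^ b) := D.coprime_e.pow_right b
    rw [← hc]
    exact Nat.dvd_gcd (orderOf_dvd_of_pow_eq_one (D.pow_card g)) (orderOf_dvd_of_pow_eq_one h2)
  rwa [Nat.dvd_one, orderOf_eq_one_iff] at h3

/-- E embeds multiplicatively in a field, so it is cyclic. A generator distinguishes the characters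
of the simple modules. -/
theorem exists_orderOf_eq : ∃ g : D.E, orderOf g = e := by
  have : IsCyclic D.E := isCyclic_of_injective_ringHom D.chi D.chi_injective
  obtain ⟨g, hg⟩ := IsCyclic.exists_ofOrder_eq_natCard (α := D.E)
  exact ⟨g, hg.trans D.card_E⟩

/-- The underlying vector space of a simple module. -/
def TEquiv (i : Fin e) : D.T i ≃+ D.k := AddEquiv.refl D.k

theorem TEquiv_smul (i : Fin e) (x : D.G) (t : D.k) (v : D.T i) :
    D.TEquiv i ((MonoidAlgebra.single x t : D.Alg) • v) =
      t * D.chi (x.right ^ (i : ℕ)) * D.TEquiv i v := by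
  have : D.TEquiv i ((MonoidAlgebra.single x t : D.Alg) • v) =
    MonoidAlgebra.lift D.k D.k D.G (D.character i) (MonoidAlgebra.single x t) * D.TEquiv i v :=
    rfl
  rw [this, MonoidAlgebra.lift_single, character_apply, smul_eq_mul]

theorem T_injective (i j : Fin e) (h : Nonempty (D.T i ≃ₗ[D.Alg] D.T j)) : i = j := by
  obtain ⟨f⟩ := h
  obtain ⟨g, hg⟩ := D.exists_orderOf_eq
  let v : D.T i := (D.TEquiv i).symm 1
  have hv : D.TEquiv j (f v) ≠ 0 := fun h0 => by
    have h1 : f v = 0 := (D.TEquiv j).injective (h0.trans (map_zero _).symm)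
    have h2 : v = 0 := f.injective (h1.trans (map_zero f).symm)
    have h3 := congrArg (D.TEquiv i) h2
    rw [map_zero, AddEquiv.apply_symm_apply] at h3
    exact one_ne_zero h3
  have h1 : (MonoidAlgebra.single (SemidirectProduct.inr g) 1 : D.Alg) • v =
      (MonoidAlgebra.single 1 (D.chi (g ^ (i : ℕ))) : D.Alg) • v := by
    apply (D.TEquiv i).injective
    rw [TEquiv_smul, TEquiv_smul]
    simp
  have h2 := congrArg (fun x => D.TEquiv j (f x)) h1
  simp only [map_smul, TEquiv_smul] at h2
  have h3 : D.chi (g ^ (j : ℕ)) = D.chi (g ^ (i : ℕ)) := by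
    simpa [hv] using h2
  have h4 := pow_injOn_Iio_orderOf (x := g) (by simp [hg]) (by simp [hg]) (D.chi_injective h3)
  exact Fin.ext h4.symm

/-! ### Coinduced modules and their submodules. -/

/-- The image of an element of `E` in `ℤ/ℓ^a`. -/
def coeE : D.E →* ZMod D.q := (Units.coeHom (ZMod D.q)).comp D.E.subtype

theorem coeE_inv_mul (g : D.E) : D.coeE g⁻¹ * D.coeE g = 1 := by
  rw [← map_mul, inv_mul_cancel, map_one]

theorem mul_left_toAdd (x y : D.G) : (x * y).left.toAdd =
    x.left.toAdd + D.coeE x.right * y.left.toAdd := rfl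

/-- The representation of `G` on the functions `ℤ/ℓ^a → k` that is coinduced from the character
`g ↦ (g mod ℓ) ^ c` of `E`. -/
def rep (c : ℕ) : Representation D.k D.G (ZMod D.q → D.k) where
  toFun x :=
    { toFun := fun f w => D.chi (x.right ^ c) * f (D.coeE x.right⁻¹ * (w + x.left.toAdd))
      map_add' := fun f f' => by ext w; simp [mul_add]
      map_smul' := fun t f => by ext w; simp [mul_left_comm] }
  map_one' := LinearMap.ext fun f => funext fun w => by simp
  map_mul' x y := by
    refine LinearMap.ext fun f => funext fun w => ?_
    simp only [LinearMap.coe_mk, AddHom.coe_mk, Module.End.mul_apply, mul_left_toAdd,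
      SemidirectProduct.mul_right]
    rw [← mul_assoc, ← map_mul, ← mul_pow]
    congr 2
    rw [mul_inv, map_mul]
    have := D.coeE_inv_mul x.right
    linear_combination (D.coeE y.right⁻¹ * y.left.toAdd) * this

theorem rep_apply (c : ℕ) (x : D.G) (f : ZMod D.q → D.k) (w : ZMod D.q) :
    D.rep c x f w = D.chi (x.right ^ c) * f (D.coeE x.right⁻¹ * (w + x.left.toAdd)) := rfl

/-- The injective indecomposable module with socle labelled `c`. -/
abbrev Coind (c : ℕ) : Type u := (D.rep c).asModule

/-- The function on `ℤ/ℓ^a` underlying an element of `Coind c`. -/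
abbrev toFn {c : ℕ} : D.Coind c ≃ₗ[D.k] (ZMod D.q → D.k) := (D.rep c).asModuleEquiv

theorem toFn_single_smul {c : ℕ} (x : D.G) (t : D.k) (f : D.Coind c) :
    D.toFn ((MonoidAlgebra.single x t : D.Alg) • f) = t • D.rep c x (D.toFn f) :=
  Representation.single_smul _ _ _ _

/-- Translation by one. -/
def shift : Module.End D.k (ZMod D.q → D.k) where
  toFun f w := f (w + 1)
  map_add' _ _ := rfl
  map_smul' _ _ := rfl

theorem shift_pow_apply (n : ℕ) (f : ZMod D.q → D.k) (w : ZMod D.q) :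
    (D.shift ^ n) f w = f (w + n) := by
  induction n generalizing w with
  | zero => simp
  | succ n ih =>
    rw [pow_succ', Module.End.mul_apply]
    change (D.shift ^ n) f (w + 1) = _
    rw [ih]
    push_cast
    ring_nf

/-- The difference operator. -/
def diff : Module.End D.k (ZMod D.q → D.k) := D.shift - 1

theorem shift_pow_q : D.shift ^ D.q = 1 := by
  refine LinearMap.ext fun f => funext fun w => ?_
  rw [shift_pow_apply]
  simp

open Polynomial in
theorem polynomial_X_sub_one_pow :
    (X - 1 : D.k[X]) ^ D.q = X ^ D.q - 1 := by
  rw [sub_pow_char_pow, one_pow]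

theorem diff_pow_q : D.diff ^ D.q = 0 := by
  have := congrArg (Polynomial.aeval D.shift) D.polynomial_X_sub_one_pow
  simp only [map_pow, map_sub, Polynomial.aeval_X, map_one] at this
  rw [diff, this, shift_pow_q, sub_self]

-- In characteristic ℓ, (X - 1)^q = X^q - 1; cancelling X - 1 leaves the geometric sum.
open Polynomial in
theorem diff_pow_q_sub_one : D.diff ^ (D.q - 1) = ∑ i ∈ Finset.range D.q, D.shift ^ i := by
  have h1 : (X - 1 : D.k[X]) ^ (D.q - 1) = ∑ i ∈ Finset.range D.q, X ^ i := by
    refine mul_right_cancel₀ (X_sub_C_ne_zero (1 : D.k)) ?_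
    rw [map_one, ← pow_succ, Nat.sub_add_cancel (Nat.pos_of_neZero D.q),
      polynomial_X_sub_one_pow, geom_sum_mul]
  have := congrArg (Polynomial.aeval D.shift) h1
  simp only [map_pow, map_sub, map_sum, Polynomial.aeval_X, map_one] at this
  exact this

/-- For the delta function at 0, only the trivial shift contributes at 0. So the difference operator
has nilpotency degree exactly q. -/
theorem exists_diff_ne_zero : ∃ f, (D.diff ^ (D.q - 1)) f 0 ≠ 0 := by
  refine ⟨Pi.single 0 1, ?_⟩
  rw [diff_pow_q_sub_one, LinearMap.sum_apply, Finset.sum_apply,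
    Finset.sum_eq_single_of_mem 0 (by simp [Nat.pos_of_neZero D.q])]
  · simp
  · intro i hi h0
    rw [shift_pow_apply, zero_add, Pi.single_eq_of_ne]
    rw [Ne, ZMod.natCast_eq_zero_iff]
    intro hd
    exact h0 (Nat.eq_zero_of_dvd_of_lt hd (Finset.mem_range.1 hi))

theorem eq_const_of_diff_eq_zero {f : ZMod D.q → D.k} (hf : D.diff f = 0) (w : ZMod D.q) :
    f w = f 0 := by
  have h1 : ∀ w, f (w + 1) = f w := fun w => sub_eq_zero.1 (congrFun hf w)
  have h2 : ∀ n : ℕ, f n = f 0 := by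
    intro n
    induction n with
    | zero => simp
    | succ n ih => rw [Nat.cast_succ, h1, ih]
  rw [← ZMod.natCast_zmod_val w]
  exact h2 _

/-- Moving the unit translation past the action of x turns it into translation by g⁻¹, where g is
the E-component of x, and `shift ^ n - 1` is a geometric sum times `shift - 1`. -/
theorem diff_comp_rep (c : ℕ) (x : D.G) :
    D.diff * D.rep c x =
      D.rep c x * ((∑ i ∈ Finset.range (D.coeE x.right⁻¹).val, D.shift ^ i) * D.diff) := by
  rw [diff, geom_sum_mul]
  refine LinearMap.ext fun f => funext fun w => ?_
  simp only [Module.End.mul_apply, LinearMap.sub_apply, Pi.sub_apply, Module.End.one_apply,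
    rep_apply, shift_pow_apply]
  change D.rep c x f (w + 1) - _ = _
  rw [rep_apply, mul_sub]
  congr 3
  rw [ZMod.natCast_zmod_val]
  ring

theorem diff_pow_comp_rep (c r : ℕ) (x : D.G) :
    D.diff ^ r * D.rep c x =
      D.rep c x * ((∑ i ∈ Finset.range (D.coeE x.right⁻¹).val, D.shift ^ i) ^ r * D.diff ^ r) := by
  set u := ∑ i ∈ Finset.range (D.coeE x.right⁻¹).val, D.shift ^ i with hu
  have hc : Commute u D.diff := by
    refine Commute.sub_right (Commute.sum_left _ _ _ fun i _ => ?_) (Commute.one_right _)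
    exact (Commute.refl _).pow_left i
  rw [← hc.mul_pow]
  induction r with
  | zero => simp
  | succ r ih => rw [pow_succ', mul_assoc, ih, ← mul_assoc, diff_comp_rep, ← hu, mul_assoc,
      ← pow_succ']

/-- Here `diff ^ r` sends f to a constant, and on constants the geometric sum of `diff_comp_rep` is
multiplication by χ(g⁻¹). Each difference therefore lowers the exponent of the character by one. -/
theorem diff_pow_rep_apply (c r : ℕ) (x : D.G) {f : ZMod D.q → D.k}
    (hf : (D.diff ^ (r + 1)) f = 0) :
    (D.diff ^ r) (D.rep c x f) 0 = D.chi (x.right ^ ((c : ℤ) - r)) * (D.diff ^ r) f 0 := by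
  have hconst := D.eq_const_of_diff_eq_zero (f := (D.diff ^ r) f)
    (by rw [← Module.End.mul_apply, ← pow_succ', hf])
  set κ := (D.diff ^ r) f 0
  have hf' : (D.diff ^ r) f = fun _ => κ := funext hconst
  have hu : ∀ t : D.k, (∑ i ∈ Finset.range (D.coeE x.right⁻¹).val, D.shift ^ i) (fun _ => t) =
      fun _ => D.chi x.right⁻¹ * t := by
    intro t
    ext w
    rw [LinearMap.sum_apply, Finset.sum_apply]
    simp only [shift_pow_apply, Finset.sum_const, Finset.card_range, nsmul_eq_mul]
    congr 1
    exact (D.reduction_apply _).symm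
  have hur : ∀ n : ℕ, ((∑ i ∈ Finset.range (D.coeE x.right⁻¹).val, D.shift ^ i) ^ n)
      (fun _ => κ) = fun _ => D.chi x.right⁻¹ ^ n * κ := by
    intro n
    induction n with
    | zero => simp
    | succ n ih => rw [pow_succ', Module.End.mul_apply, ih, hu, pow_succ']; simp only [mul_assoc]
  rw [← Module.End.mul_apply, diff_pow_comp_rep, Module.End.mul_apply, Module.End.mul_apply, hf',
    hur, rep_apply, ← mul_assoc, ← map_pow, ← map_mul, inv_pow, zpow_sub, zpow_natCast,
    zpow_natCast]

/-- The submodules of `Coind c`. -/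
def layer (c r : ℕ) : Submodule D.Alg (D.Coind c) where
  carrier := {f | (D.diff ^ r) (D.toFn f) = 0}
  add_mem' {f f'} hf hf' := by
    simp only [Set.mem_ofPred_eq, map_add] at *
    rw [hf, hf', add_zero]
  zero_mem' := by simp
  smul_mem' a f hf := by
    simp only [Set.mem_ofPred_eq] at *
    induction a using MonoidAlgebra.induction_linear with
    | zero => simp
    | add a b ha hb => rw [add_smul, map_add, map_add, ha, hb, add_zero]
    | single g t =>
      rw [toFn_single_smul, map_smul, ← Module.End.mul_apply, diff_pow_comp_rep,
        Module.End.mul_apply, Module.End.mul_apply, hf, map_zero, map_zero, smul_zero]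

theorem mem_layer {c r : ℕ} {f : D.Coind c} :
    f ∈ D.layer c r ↔ (D.diff ^ r) (D.toFn f) = 0 := Iff.rfl

theorem layer_le_succ (c r : ℕ) : D.layer c r ≤ D.layer c (r + 1) := fun f hf => by
  rw [mem_layer] at *
  rw [pow_succ', Module.End.mul_apply, hf, map_zero]

theorem exists_mem_layer (c : ℕ) {r : ℕ} (hr : r < D.q) :
    ∃ f ∈ D.layer c (r + 1), (D.diff ^ r) (D.toFn f) 0 ≠ 0 := by
  obtain ⟨f, hf⟩ := D.exists_diff_ne_zero
  refine ⟨D.toFn.symm ((D.diff ^ (D.q - 1 - r)) f), ?_, ?_⟩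
  · rw [mem_layer, LinearEquiv.apply_symm_apply, ← Module.End.mul_apply, ← pow_add,
      show r + 1 + (D.q - 1 - r) = D.q by omega, diff_pow_q, LinearMap.zero_apply]
  · rwa [LinearEquiv.apply_symm_apply, ← Module.End.mul_apply, ← pow_add,
      show r + (D.q - 1 - r) = D.q - 1 by omega]

theorem diff_apply_zero {c r : ℕ} {f : D.Coind c} (hf : f ∈ D.layer c (r + 1)) :
    f ∈ D.layer c r ↔ (D.diff ^ r) (D.toFn f) 0 = 0 := by
  rw [mem_layer]
  refine ⟨fun h => by rw [h]; rfl, fun h => funext fun w => ?_⟩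
  rw [D.eq_const_of_diff_eq_zero (f := (D.diff ^ r) (D.toFn f))
    (by rw [← Module.End.mul_apply, ← pow_succ']; exact hf), h]
  rfl

/-- The isomorphism is induced by f ↦ (`diff ^ r` f) 0; the exponent c - r matters only modulo e,
the order of E. -/
theorem quotIso_layer [NeZero e] (c : ℕ) {r : ℕ} (hr : r < D.q) :
    QuotIso (D.layer c r) (D.layer c (r + 1)) (D.T (residue e (c - r))) := by
  set i := residue e (c - r) with hi
  let φ : D.layer c (r + 1) →+ D.T i :=
    { toFun := fun f => (D.TEquiv i).symm ((D.diff ^ r) (D.toFn f.1) 0)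
      map_zero' := by simp
      map_add' := fun f f' => by simp }
  have hφ : ∀ f, D.TEquiv i (φ f) = (D.diff ^ r) (D.toFn f.1) 0 := fun f =>
    AddEquiv.apply_symm_apply _ _
  have hsmul : ∀ (g : D.G) (t : D.k) (f : D.layer c (r + 1)),
      φ ((MonoidAlgebra.single g t : D.Alg) • f) = (MonoidAlgebra.single g t : D.Alg) • φ f := by
    intro g t f
    apply (D.TEquiv i).injective
    rw [hφ, TEquiv_smul, hφ, Submodule.coe_smul, toFn_single_smul, map_smul, Pi.smul_apply,
      diff_pow_rep_apply _ _ _ _ f.2, smul_eq_mul, mul_assoc]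
    congr 3
    have h1 : ((i : ℕ) : ℤ) = ((c : ℤ) - r) % (Nat.card D.E : ℤ) := by
      rw [hi, residue_val, D.card_E]
    rw [← zpow_natCast, h1, zpow_mod_natCard]
  let ψ : D.layer c (r + 1) →ₗ[D.Alg] D.T i :=
    { φ with map_smul' := fun a f => monoidAlgebra_map_smul φ hsmul a f }
  have hψ : ∀ f, D.TEquiv i (ψ f) = (D.diff ^ r) (D.toFn f.1) 0 := hφ
  have hker : LinearMap.ker ψ = (D.layer c r).submoduleOf (D.layer c (r + 1)) := by
    ext f
    rw [LinearMap.mem_ker, ← (D.TEquiv i).map_eq_zero_iff, hψ]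
    exact (D.diff_apply_zero f.2).symm
  have hsurj : Function.Surjective ψ := by
    intro t
    obtain ⟨f, hf, h0⟩ := D.exists_mem_layer c hr
    refine ⟨(MonoidAlgebra.single 1 (D.TEquiv i t * ((D.diff ^ r) (D.toFn f) 0)⁻¹) : D.Alg) •
      ⟨f, hf⟩, ?_⟩
    apply (D.TEquiv i).injective
    rw [map_smul, TEquiv_smul, hψ]
    simp [h0]
  exact ⟨(Submodule.quotEquivOfEq _ _ hker.symm).trans (ψ.quotKerEquivOfSurjective hsurj)⟩

/-- The difference operator is the action of x - 1 for the generator x = 1 of ℤ/ℓ^a. -/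
theorem diff_mem {c : ℕ} {W : Submodule D.Alg (D.Coind c)} {f : D.Coind c} (hf : f ∈ W) (n : ℕ) :
    D.toFn.symm ((D.diff ^ n) (D.toFn f)) ∈ W := by
  induction n with
  | zero => simpa using hf
  | succ n ih =>
    set f' := D.toFn.symm ((D.diff ^ n) (D.toFn f)) with hf'
    have h1 : D.toFn.symm ((D.diff ^ (n + 1)) (D.toFn f)) =
        (MonoidAlgebra.single (SemidirectProduct.inl (Multiplicative.ofAdd 1)) 1 : D.Alg) • f' -
          f' := by
      apply D.toFn.injective
      rw [LinearEquiv.apply_symm_apply, map_sub, toFn_single_smul, pow_succ', Module.End.mul_apply,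
        ← D.toFn.apply_symm_apply ((D.diff ^ n) (D.toFn f)), ← hf']
      ext w
      rw [one_smul, Pi.sub_apply, rep_apply]
      simp [diff, shift]
    rw [h1]
    exact W.sub_mem (W.smul_mem _ ih) ih

/-- The element `diff ^ (r - s)` f of `W` spans layer s + 1 modulo layer s, so the layers are filled
one after another. -/
theorem layer_le_of_mem {c r : ℕ} {W : Submodule D.Alg (D.Coind c)} {f : D.Coind c} (hf : f ∈ W)
    (hr : f ∈ D.layer c (r + 1)) (h0 : f ∉ D.layer c r) (s : ℕ) (hs : s ≤ r + 1) :
    D.layer c s ≤ W := by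
  induction s with
  | zero =>
    intro g hg
    have : g = 0 := D.toFn.injective (by rw [map_zero]; exact hg)
    rw [this]
    exact W.zero_mem
  | succ s ih =>
    intro g hg
    rw [D.diff_apply_zero hr] at h0
    set κ := (D.diff ^ r) (D.toFn f) 0
    set f' := D.toFn.symm ((D.diff ^ (r - s)) (D.toFn f)) with hf'
    have hf's : ∀ n, (D.diff ^ n) (D.toFn f') = (D.diff ^ (n + (r - s))) (D.toFn f) := by
      intro n
      rw [hf', LinearEquiv.apply_symm_apply, ← Module.End.mul_apply, ← pow_add]
    have hmem : f' ∈ D.layer c (s + 1) := by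
      rw [mem_layer, hf's, show s + 1 + (r - s) = r + 1 by omega]
      exact hr
    set b : D.Alg := MonoidAlgebra.single 1 ((D.diff ^ s) (D.toFn g) 0 * κ⁻¹)
    have h1 : g - b • f' ∈ D.layer c s := by
      rw [D.diff_apply_zero (Submodule.sub_mem _ hg (Submodule.smul_mem _ _ hmem)), map_sub,
        map_sub, toFn_single_smul, map_one, Module.End.one_apply, map_smul, hf's,
        show s + (r - s) = r by omega, Pi.sub_apply, Pi.smul_apply, smul_eq_mul,
        inv_mul_cancel_right₀ h0, sub_self]
    have h2 := W.add_mem (ih (by omega) h1) (W.smul_mem b (D.diff_mem hf (r - s)))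
    rwa [← hf', sub_add_cancel] at h2

theorem isUniserial_coind [NeZero e] (c : ℕ) :
    IsUniserial D.T (residue e) (D.Coind c) c D.q (D.layer c) where
  bot := by
    rw [eq_bot_iff]
    intro f hf
    exact D.toFn.injective (by rw [map_zero]; exact hf)
  top := by
    rw [eq_top_iff]
    intro f _
    rw [mem_layer, diff_pow_q, LinearMap.zero_apply]
  lt r hr := by
    refine lt_of_le_of_ne (D.layer_le_succ c r) fun heq => ?_
    obtain ⟨f, hf, h0⟩ := D.exists_mem_layer c hr
    exact h0 ((D.diff_apply_zero hf).1 (heq ▸ hf))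
  factor r hr := D.quotIso_layer c hr
  exists_eq W := by
    classical
    have hex : ∃ r, W ≤ D.layer c r := ⟨D.q, fun f _ => by
      rw [mem_layer, diff_pow_q, LinearMap.zero_apply]⟩
    refine ⟨Nat.find hex, Nat.find_min' hex fun f _ => by
      rw [mem_layer, diff_pow_q, LinearMap.zero_apply], le_antisymm (Nat.find_spec hex) ?_⟩
    rcases Nat.eq_zero_or_pos (Nat.find hex) with h | h
    · rw [h]
      intro g hg
      have : g = 0 := D.toFn.injective (by rw [map_zero]; exact hg)
      rw [this]
      exact W.zero_mem
    · have h1 := Nat.find_min hex (show Nat.find hex - 1 < Nat.find hex by omega)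
      obtain ⟨f, hf, hf0⟩ := SetLike.not_le_iff_exists.1 h1
      refine D.layer_le_of_mem hf ?_ hf0 _ (by omega)
      rw [Nat.sub_add_cancel h]
      exact Nat.find_spec hex hf

/-- Any linear extension can be averaged over E, because e is invertible in k. -/
theorem exists_equivariant_extension (c : ℕ) {I : Submodule D.k D.Alg} (φ : I →ₗ[D.k] D.k)
    (hI : ∀ (x : D.G), ∀ a ∈ I, MonoidAlgebra.single x 1 * a ∈ I)
    (hφ : ∀ (h : D.E) (a : I), φ ⟨_, hI (SemidirectProduct.inr h) a a.2⟩ = D.chi (h ^ c) * φ a) :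
    ∃ ψ : D.Alg →ₗ[D.k] D.k, (∀ a : I, ψ a = φ a) ∧
      ∀ (h : D.E) (a : D.Alg),
        ψ (MonoidAlgebra.single (SemidirectProduct.inr h) 1 * a) = D.chi (h ^ c) * ψ a := by
  obtain ⟨ψ₀, hψ₀⟩ := LinearMap.exists_extend φ
  have hψ₀' : ∀ a (ha : a ∈ I), ψ₀ a = φ ⟨a, ha⟩ := fun a ha => LinearMap.congr_fun hψ₀ ⟨a, ha⟩
  have : Fintype D.E := Fintype.ofFinite _
  let ψ : D.Alg →ₗ[D.k] D.k := (e : D.k)⁻¹ • ∑ h : D.E, D.chi (h⁻¹ ^ c) •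
    ψ₀.comp (LinearMap.mulLeft D.k (MonoidAlgebra.single (SemidirectProduct.inr h) 1))
  have hψ : ∀ a, ψ a = (e : D.k)⁻¹ * ∑ h : D.E, D.chi (h⁻¹ ^ c) *
      ψ₀ (MonoidAlgebra.single (SemidirectProduct.inr h) 1 * a) := by
    intro a
    simp [ψ]
  refine ⟨ψ, fun a => ?_, fun h a => ?_⟩
  · rw [hψ, Finset.sum_congr rfl (g := fun _ => φ a), Finset.sum_const, Finset.card_univ,
      ← Nat.card_eq_fintype_card, D.card_E, nsmul_eq_mul,
      inv_mul_cancel_left₀ D.natCast_e_ne_zero]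
    intro h _
    rw [hψ₀' _ (hI _ a a.2), hφ, ← mul_assoc, ← map_mul, ← mul_pow, inv_mul_cancel, one_pow,
      map_one, one_mul]
  · rw [hψ, hψ, mul_left_comm, Finset.mul_sum (a := D.chi _)]
    refine congrArg _ ?_
    refine Fintype.sum_equiv (Equiv.mulRight h) _ _ fun g => ?_
    rw [Equiv.coe_mulRight, ← mul_assoc (MonoidAlgebra.single _ _), MonoidAlgebra.single_mul_single,
      one_mul, ← map_mul SemidirectProduct.inr, ← mul_assoc (D.chi _), ← map_mul D.chi, ← mul_pow,
      mul_inv_rev, mul_inv_cancel_left]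

/-- Baer's criterion combined with Frobenius reciprocity: evaluation at 0 turns a homomorphism from
a left ideal into an E-equivariant functional. This functional extends to the whole algebra, and the
extension ψ gives back the homomorphism a ↦ (w ↦ ψ(w a)). -/
theorem injective_coind (c : ℕ) : Module.Injective D.Alg (D.Coind c) := by
  refine Module.Baer.injective fun I g => ?_
  have hmem : ∀ a : I.restrictScalars D.k, (a : D.Alg) ∈ I := fun a => a.2
  have hg : ∀ (x : D.G) (t : D.k) (a : D.Alg) (ha : a ∈ I)
      (hb : MonoidAlgebra.single x t * a ∈ I),
      D.toFn (g ⟨MonoidAlgebra.single x t * a, hb⟩) = t • D.rep c x (D.toFn (g ⟨a, ha⟩)) := by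
    intro x t a ha hb
    have : (⟨MonoidAlgebra.single x t * a, hb⟩ : I) =
      (MonoidAlgebra.single x t : D.Alg) • ⟨a, ha⟩ := rfl
    rw [this, map_smul, toFn_single_smul]
  let φ : I.restrictScalars D.k →ₗ[D.k] D.k :=
    { toFun := fun a => D.toFn (g ⟨a, hmem a⟩) 0
      map_add' := fun a b => by
        have : (⟨(a + b : I.restrictScalars D.k), hmem (a + b)⟩ : I) =
          ⟨a, hmem a⟩ + ⟨b, hmem b⟩ := rfl
        rw [this, map_add, map_add, Pi.add_apply]
      map_smul' := fun t a => by
        have h2 : ((t • a : I.restrictScalars D.k) : D.Alg) =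
            MonoidAlgebra.single 1 t * (a : D.Alg) := by
          rw [Submodule.coe_smul, Algebra.smul_def]; rfl
        have h3 : MonoidAlgebra.single 1 t * (a : D.Alg) ∈ I := I.smul_mem _ (hmem a)
        simp only [h2]
        rw [hg 1 t a (hmem a) h3, map_one]
        rfl }
  have hI : ∀ (x : D.G), ∀ a ∈ I.restrictScalars D.k,
      MonoidAlgebra.single x 1 * a ∈ I.restrictScalars D.k := fun x a ha => I.smul_mem _ ha
  have hφ : ∀ (x : D.G) (a : I.restrictScalars D.k),
      φ ⟨_, hI x a a.2⟩ = D.rep c x (D.toFn (g ⟨a, hmem a⟩)) 0 := by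
    intro x a
    change D.toFn (g ⟨MonoidAlgebra.single x 1 * (a : D.Alg), hmem ⟨_, hI x a a.2⟩⟩) 0 = _
    rw [hg x 1 a (hmem a), one_smul]
  obtain ⟨ψ, hψ, hψE⟩ := D.exists_equivariant_extension c φ hI fun h a => by
    rw [hφ, rep_apply, SemidirectProduct.right_inr, SemidirectProduct.left_inr, toAdd_one,
      add_zero, mul_zero]
    rfl
  let f : D.Alg →+ D.Coind c :=
    { toFun := fun a => D.toFn.symm fun w => ψ (MonoidAlgebra.single
        (SemidirectProduct.inl (Multiplicative.ofAdd w)) 1 * a)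
      map_zero' := by simp; rfl
      map_add' := fun a b => by
        apply D.toFn.injective
        ext w
        simp [mul_add] }
  have hf : ∀ a w, D.toFn (f a) w = ψ (MonoidAlgebra.single
        (SemidirectProduct.inl (Multiplicative.ofAdd w)) 1 * a) := fun a w => rfl
  refine ⟨{ f with map_smul' := monoidAlgebra_map_smul f fun x t a => ?_ }, fun a ha => ?_⟩
  · apply D.toFn.injective
    ext w
    rw [hf, toFn_single_smul, Pi.smul_apply, rep_apply, hf, ← hψE, smul_eq_mul, smul_eq_mul,
      ← mul_assoc, ← mul_assoc, MonoidAlgebra.single_mul_single, MonoidAlgebra.single_mul_single,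
      ← smul_eq_mul t, ← map_smul, ← smul_mul_assoc, MonoidAlgebra.smul_single]
    congr 3
    · have h1 : (SemidirectProduct.inr x.right * SemidirectProduct.inl (Multiplicative.ofAdd
          (D.coeE x.right⁻¹ * (w + x.left.toAdd))) : D.G) =
          SemidirectProduct.inl (Multiplicative.ofAdd w) * x := by
        refine SemidirectProduct.ext ?_ (by simp)
        apply Multiplicative.toAdd.injective
        rw [mul_left_toAdd, mul_left_toAdd]
        simp only [SemidirectProduct.left_inr, SemidirectProduct.right_inr,
          SemidirectProduct.left_inl, SemidirectProduct.right_inl, toAdd_one, toAdd_ofAdd, map_one]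
        have := D.coeE_inv_mul x.right
        linear_combination (w + x.left.toAdd) * this
      rw [h1]
    · simp
  · apply D.toFn.injective
    ext w
    change D.toFn (f a) w = _
    rw [hf, hψ ⟨_, hI _ a ha⟩, hφ _ ⟨a, ha⟩, rep_apply]
    simp

theorem exists_injective_isUniserial [NeZero e] (c : ℤ) :
    ∃ P : ModuleCat.{u} D.Alg, Module.Injective D.Alg P ∧
      ∃ K, IsUniserial D.T (residue e) P c D.q K := by
  refine ⟨ModuleCat.of _ (D.Coind (residue e c)), D.injective_coind _, D.layer _,
    (D.isUniserial_coind _).congr_label fun s => ?_⟩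
  rw [residue_eq_iff, residue_val, Int.emod_sub_emod]

theorem q_sub_one : ∃ m : ℕ, 0 < m ∧ D.q = m * e + 1 := by
  have h : e ∣ D.q - 1 := D.e_dvd.trans (by simpa using Nat.sub_dvd_pow_sub_pow D.ℓ 1 D.a)
  obtain ⟨m, hm⟩ := h
  have h1 : 1 < D.q := Nat.one_lt_pow D.a_pos.ne' D.prime.out.one_lt
  refine ⟨m, Nat.pos_of_ne_zero ?_, by rw [mul_comm]; omega⟩
  rintro rfl
  omega

end Datum

/-! ### Walks on the integer line -/

/-- The positions of the socles of the modules `L_j` computed by the algorithm, on the universal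
cover of the cycle of simple modules.  The perversity function is pulled back to `P : ℤ → ℕ`. -/
structure IsWalk (P : ℤ → ℕ) (w : ℤ) (p : ℕ → ℤ) : Prop where
  start : ∀ j, P w < j → p j = w
  lt : ∀ j, 1 ≤ j → j ≤ P w → p j < p (j + 2)
  le : ∀ j, 1 ≤ j → j ≤ P w → j ≤ P (p j)
  skip : ∀ j, 1 ≤ j → j ≤ P w → ∀ z, p j < z → z < p (j + 2) → P z < j

/-- A walk is constant beyond its starting index and each position is found from the one two indices
above, so facts about walks are proved from large j downwards. -/
theorem downward_induction {n : ℕ} {Q : ℕ → Prop} (h₀ : ∀ j, n < j → Q j)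
    (h : ∀ j, 1 ≤ j → j ≤ n → Q (j + 1) → Q (j + 2) → Q j) (j : ℕ) (hj : 1 ≤ j) : Q j := by
  induction hk : n + 1 - j using Nat.strong_induction_on generalizing j with
  | _ k ih =>
    by_cases hjn : n < j
    · exact h₀ j hjn
    · exact h j hj (by omega) (ih _ (by omega) _ (by omega) rfl) (ih _ (by omega) _ (by omega) rfl)

theorem exists_greatest_lt {Q : ℤ → Prop} {e : ℕ} (he : 0 < e)
    (hQ : ∀ z t : ℤ, Q (z + t * e) ↔ Q z) (hex : ∃ z, Q z) (u : ℤ) :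
    ∃ y, y < u ∧ Q y ∧ ∀ z, y < z → z < u → ¬ Q z := by
  obtain ⟨w, hw⟩ := hex
  have hlow : ∃ y, y < u ∧ Q y := by
    refine ⟨w + (-(|w| + |u| + 1)) * e, ?_, (hQ _ _).2 hw⟩
    have h1 : (1 : ℤ) ≤ e := by exact_mod_cast he
    have := le_abs_self w
    have := neg_abs_le u
    nlinarith [abs_nonneg w, abs_nonneg u]
  obtain ⟨y, ⟨hyu, hy⟩, hmax⟩ := Int.exists_greatest_of_bdd (P := fun y => y < u ∧ Q y)
    ⟨u, fun z hz => hz.1.le⟩ hlow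
  exact ⟨y, hyu, hy, fun z hyz hzu hz => (hmax z ⟨hzu, hz⟩).not_gt hyz⟩

theorem exists_least_gt {Q : ℤ → Prop} {e : ℕ} (he : 0 < e)
    (hQ : ∀ z t : ℤ, Q (z + t * e) ↔ Q z) (hex : ∃ z, Q z) (u : ℤ) :
    ∃ y, u < y ∧ Q y ∧ ∀ z, u < z → z < y → ¬ Q z := by
  obtain ⟨y, hy, hQy, hmax⟩ := exists_greatest_lt (Q := fun z => Q (-z)) he
    (fun z t => by rw [← hQ (-z) (-t)]; ring_nf) (by simpa using hex.imp' (- ·) (by simp)) (-u)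
  exact ⟨-y, by omega, hQy, fun z h₁ h₂ => by simpa using hmax (-z) (by omega) (by omega)⟩

theorem exists_isWalk {P : ℤ → ℕ} {e : ℕ} (he : 0 < e) (hP : ∀ z t : ℤ, P (z + t * e) = P z)
    (w : ℤ) : ∃ p, IsWalk P w p := by
  have hstep : ∀ (k : ℕ) (u : ℤ), ∃ y, y < u ∧ P w - k ≤ P y ∧
      ∀ z, y < z → z < u → ¬ P w - k ≤ P z := fun k u =>
    exists_greatest_lt he (fun z t => by rw [hP]) ⟨w, Nat.sub_le _ _⟩ u
  choose F hF₁ hF₂ hF₃ using hstep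
  -- With n = P w, `b k` is the pair (p (n + 2 - k), p (n + 1 - k)), which lets the recursion look
  -- two indices back.
  let b : ℕ → ℤ × ℤ := fun k => Nat.rec (w, w) (fun k q => (q.2, F k q.1)) k
  have hb : ∀ k, (b (k + 2)).1 = F k (b k).1 := fun k => rfl
  have hp : ∀ j, j ≤ P w → (b (P w + 2 - j)).1 = F (P w - j) (b (P w + 2 - (j + 2))).1 := by
    intro j hj
    rw [show P w + 2 - j = (P w - j) + 2 by omega, hb, show P w + 2 - (j + 2) = P w - j by omega]
  refine ⟨fun j => (b (P w + 2 - j)).1, ?_, ?_, ?_, ?_⟩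
  · intro j hj
    rcases (show P w + 2 - j = 0 ∨ P w + 2 - j = 1 by omega) with h | h <;> simp only [h] <;> rfl
  · intro j _ hj
    simp only [hp j hj]
    exact hF₁ _ _
  · intro j _ hj
    have := hF₂ (P w - j) (b (P w + 2 - (j + 2))).1
    simp only [hp j hj]
    omega
  · intro j _ hj z h₁ h₂
    simp only [hp j hj] at h₁
    have := hF₃ (P w - j) (b (P w + 2 - (j + 2))).1 z h₁ h₂
    omega

theorem IsWalk.unique {P : ℤ → ℕ} {w : ℤ} {p p' : ℕ → ℤ} (h : IsWalk P w p) (h' : IsWalk P w p')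
    (j : ℕ) (hj : 1 ≤ j) : p j = p' j := by
  refine downward_induction (n := P w) (Q := fun j => p j = p' j)
    (fun j hj => (h.start j hj).trans (h'.start j hj).symm) (fun j h1 hn _ ih => ?_) j hj
  by_contra hne
  rcases lt_or_gt_of_ne hne with hlt | hlt
  · have := h.skip j h1 hn _ hlt (by rw [ih]; exact h'.lt j h1 hn)
    have := h'.le j h1 hn
    omega
  · have := h'.skip j h1 hn _ hlt (by rw [← ih]; exact h.lt j h1 hn)
    have := h.le j h1 hn
    omega

/-- Bounds for the distance of two consecutive positions. -/
theorem IsWalk.bounds {P : ℤ → ℕ} {e : ℕ} (he : 0 < e) (hP : ∀ z t : ℤ, P (z + t * e) = P z)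
    {w : ℤ} {p : ℕ → ℤ} (h : IsWalk P w p) (j : ℕ) (hj : 1 ≤ j) (hjn : j ≤ P w + 1) :
    (Even (P w + 1 - j) → p (j + 1) ≤ p j ∧ p j < p (j + 1) + e) ∧
      (¬ Even (P w + 1 - j) → p j < p (j + 1) ∧ p (j + 1) ≤ p j + e) := by
  have key := downward_induction (n := P w) (Q := fun j => j ≤ P w + 1 →
    (Even (P w + 1 - j) → p (j + 1) ≤ p j ∧ p j < p (j + 1) + e) ∧
      (¬ Even (P w + 1 - j) → p j < p (j + 1) ∧ p (j + 1) ≤ p j + e)) ?_ ?_ j hj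
  · exact key hjn
  · intro j hj hj'
    obtain rfl : j = P w + 1 := by omega
    rw [h.start _ (by omega), h.start _ (by omega)]
    simp [he]
  · intro j h1 hn ih _ _
    have hpar : Even (P w + 1 - j) ↔ ¬ Even (P w + 1 - (j + 1)) := by
      rw [show P w + 1 - j = (P w + 1 - (j + 1)) + 1 by omega, Nat.even_add_one]
    have hlt := h.lt j h1 hn
    -- Because of this value, the step from `p (j + 2)` to `p j` can jump neither over `p (j + 1)`
    -- nor, by periodicity, over `p (j + 1) - e`.
    have hPj : j ≤ P (p (j + 1)) := by
      by_cases hj' : j + 1 ≤ P w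
      · have := h.le (j + 1) (by omega) hj'
        omega
      · rw [h.start (j + 1) (by omega)]
        exact hn
    rw [hpar, not_not]
    constructor
    · intro hodd
      obtain ⟨h2, h3⟩ := (ih (by omega)).2 hodd
      refine ⟨?_, by simp only [add_assoc, Nat.reduceAdd] at *; omega⟩
      by_contra! h4
      have := h.skip j h1 hn _ h4 h2
      omega
    · intro heven
      obtain ⟨h2, h3⟩ := (ih (by omega)).1 heven
      simp only [add_assoc, Nat.reduceAdd] at *
      refine ⟨by omega, ?_⟩
      by_contra! h4
      have := h.skip j h1 hn (p (j + 1) - e) (by omega) (by omega)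
      have h5 := hP (p (j + 1)) (-1)
      rw [show p (j + 1) + -1 * e = p (j + 1) - e by ring] at h5
      omega

/-! ### Shifting a perversity function along a closed set -/

/-- `f` and `g` are consecutive elements of `S`. -/
structure Adj (S : Set ℤ) (f g : ℤ) : Prop where
  left : f ∈ S
  right : g ∈ S
  lt : f < g
  notMem : ∀ z, f < z → z < g → z ∉ S

theorem Adj.le_of_lt {S : Set ℤ} {f g z : ℤ} (h : Adj S f g) (hz : z ∈ S) (hlt : z < g) :
    z ≤ f := by
  by_contra! hf
  exact h.notMem z hf hlt hz

theorem Adj.le_of_gt {S : Set ℤ} {f g z : ℤ} (h : Adj S f g) (hz : z ∈ S) (hlt : f < z) :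
    g ≤ z := by
  by_contra! hf
  exact h.notMem z hlt hf hz

theorem Adj.right_unique {S : Set ℤ} {f g g' : ℤ} (h : Adj S f g) (h' : Adj S f g') : g = g' :=
  le_antisymm (h.le_of_gt h'.right h'.lt) (h'.le_of_gt h.right h.lt)

theorem Adj.left_unique {S : Set ℤ} {f f' g : ℤ} (h : Adj S f g) (h' : Adj S f' g) : f = f' :=
  le_antisymm (h'.le_of_lt h.left h.lt) (h.le_of_lt h'.left h'.lt)

/-- The perversity function `P'` is obtained from `P` by moving it one step upwards along `S` and
adding `2` there, where `S` is closed for `P`. -/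
structure IsShift (e : ℕ) (P P' : ℤ → ℕ) (S : Set ℤ) : Prop where
  pos : 0 < e
  periodic : ∀ z t : ℤ, P (z + t * e) = P z
  mem_iff : ∀ z t : ℤ, z + t * e ∈ S ↔ z ∈ S
  off : ∀ z ∉ S, P' z = P z
  on : ∀ f g, Adj S f g → P' g = P f + 2
  closed : ∀ w p, IsWalk P w p → ∀ j, 1 ≤ j → j ≤ P w → ∀ z, p j < z → z < p (j + 2) →
    z ∈ S → w ∈ S

namespace IsShift

variable {e : ℕ} {P P' : ℤ → ℕ} {S : Set ℤ} (hS : IsShift e P P' S)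
include hS

theorem exists_adj_left {g : ℤ} (hg : g ∈ S) : ∃ f, Adj S f g := by
  obtain ⟨f, hf, hfS, hmax⟩ := exists_greatest_lt hS.pos (Q := (· ∈ S)) hS.mem_iff ⟨g, hg⟩ g
  exact ⟨f, hfS, hg, hf, hmax⟩

theorem exists_adj_right {f : ℤ} (hf : f ∈ S) : ∃ g, Adj S f g := by
  obtain ⟨g, hg, hgS, hmax⟩ := exists_least_gt hS.pos (Q := (· ∈ S)) hS.mem_iff ⟨f, hf⟩ f
  exact ⟨g, hf, hgS, hg, hmax⟩

/-- An element outside `S` lies between two consecutive elements of `S`. -/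
theorem exists_adj_of_notMem (hne : S.Nonempty) {z : ℤ} (hz : z ∉ S) :
    ∃ f g, Adj S f g ∧ f < z ∧ z < g := by
  obtain ⟨f, hf, hfS, hmax⟩ := exists_greatest_lt hS.pos (Q := (· ∈ S)) hS.mem_iff hne z
  obtain ⟨g, hg⟩ := hS.exists_adj_right hfS
  refine ⟨f, g, hg, hf, ?_⟩
  by_contra! h
  rcases h.eq_or_lt with rfl | h
  · exact hz hg.right
  · exact hmax g hg.lt h hg.right

/-- If P z exceeded P f, then by induction every position from f up to z would be lower than P z.
The first step of the walk from z would skip f, and closedness would put z in S. -/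
theorem le_of_notMem {f z : ℤ} (hf : f ∈ S) (hfz : f < z) (hz : ∀ y, f < y → y ≤ z → y ∉ S) :
    P z ≤ P f := by
  induction hk : (z - f).toNat using Nat.strong_induction_on generalizing z with
  | _ k ih =>
    by_contra! hlt
    obtain ⟨p, hp⟩ := exists_isWalk hS.pos hS.periodic z
    have h1 : 1 ≤ P z := by omega
    have h2 := hp.lt _ h1 le_rfl
    have h3 := hp.le _ h1 le_rfl
    rw [hp.start (P z + 2) (by omega)] at h2
    have h4 : p (P z) < f := by
      by_contra! h4
      rcases h4.eq_or_lt with h5 | h5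
      · rw [← h5] at h3; omega
      · have := ih _ (by omega) h5 (fun y h6 h7 => hz y h6 (by omega)) rfl
        omega
    exact hz z hfz le_rfl (hS.closed z p hp _ h1 le_rfl f h4
      (by rw [hp.start _ (by omega)]; exact hfz) hf)

theorem le_of_adj {f g z : ℤ} (h : Adj S f g) (hf : f < z) (hg : z < g) : P z ≤ P f :=
  hS.le_of_notMem h.left hf fun y h1 h2 => h.notMem y h1 (by omega)

/-- The walk skips no element of S, so only its stops in S need care. If such a stop p j = g became
too low, its predecessor f in S would satisfy P f + 2 < j. Then nothing in [f, g) could be the stop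
p (j - 2), and the walk would skip f. -/
theorem isWalk_of_notMem {w : ℤ} {p : ℕ → ℤ} (hw : w ∉ S) (hp : IsWalk P w p) :
    IsWalk P' w p := by
  have hPw := hS.off w hw
  refine ⟨fun j hj => hp.start j (by omega), fun j h1 hn => hp.lt j h1 (by omega),
    fun j h1 hn => ?_, fun j h1 hn z hz hz' => ?_⟩
  · have hle := hp.le j h1 (by omega)
    by_cases hpj : p j ∈ S
    · obtain ⟨f, hf⟩ := hS.exists_adj_left hpj
      rw [hS.on _ _ hf]
      by_contra! hlt
      obtain ⟨i, rfl⟩ : ∃ i, j = i + 2 := ⟨j - 2, by omega⟩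
      have h2 := hp.lt i (by omega) (by omega)
      have h3 := hp.le i (by omega) (by omega)
      have h4 : p i < f := by
        by_contra! h4
        rcases h4.eq_or_lt with h5 | h5
        · rw [← h5] at h3; omega
        · have := hS.le_of_adj hf h5 h2
          omega
      exact hw (hS.closed w p hp i (by omega) (by omega) f h4 hf.lt hf.left)
    · rwa [hS.off _ hpj]
  · have hzS : z ∉ S := fun h => hw (hS.closed w p hp j h1 (by omega) z hz hz' h)
    rw [hS.off z hzS]
    exact hp.skip j h1 (by omega) z hz hz'

end IsShift

/-- The relation between the position `p j` of a walk for `P` and the position `p' (j + 2)` of the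
corresponding walk for the shifted function. -/
structure Rel (P : ℤ → ℕ) (S : Set ℤ) (p p' : ℕ → ℤ) (j : ℕ) : Prop where
  lt : p j < p' (j + 2)
  notMem : ∀ z, p j < z → z < p' (j + 2) → z ∉ S
  skip : ∀ z, p j < z → z < p' (j + 2) → P z < j

namespace IsShift

variable {e : ℕ} {P P' : ℤ → ℕ} {S : Set ℤ} (hS : IsShift e P P' S) {w w' : ℤ} {p p' : ℕ → ℤ}
  (hw : Adj S w w') (hp : IsWalk P w p) (hp' : IsWalk P' w' p')
include hS hw hp hp'

theorem rel_start (j : ℕ) (hj : P w < j) : Rel P S p p' j := by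
  have hP := hS.on _ _ hw
  have h1 := hp.start j hj
  have h2 := hp'.start (j + 2) (by omega)
  constructor
  · rw [h1, h2]; exact hw.lt
  · rw [h1, h2]; exact hw.notMem
  · rw [h1, h2]
    intro z hz hz'
    have := hS.le_of_adj hw hz hz'
    omega

/-- The value at `p j` is unchanged, so p' cannot skip it, and by `Rel` nothing between `p j` and
`p' (j + 2)` is high enough to stop earlier. -/
theorem eq_of_notMem {j : ℕ} (hj : 1 ≤ j) (hR : Rel P S p p' j) (hpj : p j ∉ S) :
    p' j = p j := by
  have hP := hS.on _ _ hw
  have hjn : j ≤ P w := by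
    by_contra! hj
    rw [hp.start j hj] at hpj
    exact hpj hw.left
  have h1 := hp.le j hj hjn
  have h2 := hp'.lt j hj (by omega)
  have h3 := hp'.le j hj (by omega)
  rcases lt_trichotomy (p' j) (p j) with hlt | heq | hlt
  · have := hp'.skip j hj (by omega) _ hlt hR.lt
    rw [hS.off _ hpj] at this
    omega
  · exact heq
  · have h4 := hR.notMem _ hlt h2
    have h5 := hR.skip _ hlt h2
    rw [hS.off _ h4] at h3
    omega

-- `Rel` excludes a stop above `p j`. A stop of p' inside a gap (f, g) of S would mean skipping g,
-- whose new value P f + 2 exceeds all values in that gap.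
omit hp in
theorem mem_of_mem {j : ℕ} (hj : 1 ≤ j) (hjn : j ≤ P w + 2) (hR : Rel P S p p' j)
    (hpj : p j ∈ S) : p' j ∈ S ∧ p' j ≤ p j := by
  have hP := hS.on _ _ hw
  have h2 := hp'.lt j hj (by omega)
  have h3 := hp'.le j hj (by omega)
  have hle : p' j ≤ p j := by
    by_contra! hlt
    have h4 := hR.notMem _ hlt h2
    have h5 := hR.skip _ hlt h2
    rw [hS.off _ h4] at h3
    omega
  refine ⟨?_, hle⟩
  by_contra hmem
  rw [hS.off _ hmem] at h3
  obtain ⟨f, g, hfg, hf, hg⟩ := hS.exists_adj_of_notMem ⟨_, hpj⟩ hmem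
  have hgle : g ≤ p j := by
    refine hfg.le_of_gt hpj (hf.trans_le hle)
  have h4 := hp'.skip j hj (by omega) g hg (hgle.trans_lt hR.lt)
  rw [hS.on _ _ hfg] at h4
  have := hS.le_of_adj hfg hf hg
  omega

theorem rel_step {j : ℕ} (hj : 1 ≤ j) (hjn : j ≤ P w) (hR : Rel P S p p' (j + 2)) :
    Rel P S p p' j := by
  have hP := hS.on _ _ hw
  have hlt := hp.lt j hj hjn
  have hle := hp.le j hj hjn
  by_cases hmem : p (j + 2) ∈ S
  · obtain ⟨h1, h2⟩ := hS.mem_of_mem hw hp' (by omega) (by omega) hR hmem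
    obtain ⟨g, hg⟩ := hS.exists_adj_left h1
    have h3 := hp'.le (j + 2) (by omega) (by omega)
    rw [hS.on _ _ hg] at h3
    -- The stop `p' (j + 2)` has new value P g + 2, at least j + 2, so p cannot skip g.
    have h4 : g ≤ p j := by
      by_contra! h4
      have := hp.skip j hj hjn g h4 (hg.lt.trans_le h2)
      omega
    have h5 : p j < p' (j + 2) := by
      by_contra! h5
      -- Let f be the last element of S up to `p j` and y its successor. Then p' skips y, whence P f
      -- < j, although P (p j) is at least j and bounded by P f.
      have hfl : ∃ f y, Adj S f y ∧ f ≤ p j ∧ p j < y ∧ p' (j + 2) ≤ f := by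
        by_cases hpj : p j ∈ S
        · obtain ⟨y, hy⟩ := hS.exists_adj_right hpj
          exact ⟨_, y, hy, le_rfl, hy.lt, h5⟩
        · obtain ⟨f, y, hfy, h6, h7⟩ := hS.exists_adj_of_notMem ⟨_, hmem⟩ hpj
          exact ⟨f, y, hfy, h6.le, h7, hfy.le_of_lt h1 (h5.trans_lt h7)⟩
      obtain ⟨f, y, hfy, h6, h7, h8⟩ := hfl
      have h9 : y ≤ p (j + 2) := hfy.le_of_gt hmem (h6.trans_lt hlt)
      have h10 := hp'.skip (j + 2) (by omega) (by omega) y (h8.trans_lt hfy.lt)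
        (h9.trans_lt hR.lt)
      rw [hS.on _ _ hfy] at h10
      rcases h6.eq_or_lt with h11 | h11
      · rw [h11] at h10; omega
      · have := hS.le_of_adj hfy h11 h7
        omega
    exact ⟨h5, fun z hz => hg.notMem z (h4.trans_lt hz),
      fun z hz hz' => hp.skip j hj hjn z hz (hz'.trans_le h2)⟩
  · have h1 := hS.eq_of_notMem hw hp hp' (by omega) hR hmem
    obtain ⟨f, g, hfg, hf, hg⟩ := hS.exists_adj_of_notMem ⟨_, hw.left⟩ hmem
    -- Skipping f would give P f < j, but P f bounds the value at `p (j + 2)`, which is at least j +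
    -- 2.
    have h2 : f ≤ p j := by
      by_contra! h2
      have h3 := hp.skip j hj hjn f h2 hf
      have h4 := hS.le_of_adj hfg hf hg
      have h5 : j + 2 ≤ P (p (j + 2)) := by
        refine hp.le _ (by omega) ?_
        by_contra! h5
        rw [hp.start _ h5] at hmem
        exact hmem hw.left
      omega
    exact ⟨h1 ▸ hlt, fun z hz hz' => hfg.notMem z (h2.trans_lt hz) (by omega),
      fun z hz hz' => hp.skip j hj hjn z hz (h1 ▸ hz')⟩

theorem rel (j : ℕ) (hj : 1 ≤ j) : Rel P S p p' j :=
  downward_induction (hS.rel_start hw hp hp') (fun _ h1 hn _ => hS.rel_step hw hp hp' h1 hn) j hj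

/-- New values on S are at least 2, so p' skips no element of S in its steps 1 and 2. -/
theorem eq_of_le_two {j : ℕ} (hj : 1 ≤ j) (hj2 : j ≤ 2) : p' j = p j := by
  have hP := hS.on _ _ hw
  have hR := hS.rel hw hp hp' j hj
  by_cases hmem : p j ∈ S
  · obtain ⟨h1, h2⟩ := hS.mem_of_mem hw hp' hj (by omega) hR hmem
    refine le_antisymm h2 ?_
    by_contra! hlt
    obtain ⟨f, hf⟩ := hS.exists_adj_left hmem
    have := hp'.skip j hj (by omega) _ hlt hR.lt
    rw [hS.on _ _ hf] at this
    omega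
  · exact hS.eq_of_notMem hw hp hp' hj hR hmem

theorem notMem_of_le_two {j : ℕ} (hj : 1 ≤ j) (hj2 : j ≤ 2) {z : ℤ} (hz : p' j < z)
    (hz' : z < p' (j + 2)) : z ∉ S := by
  rw [hS.eq_of_le_two hw hp hp' hj hj2] at hz
  exact (hS.rel hw hp hp' j hj).notMem z hz hz'

/-- Here `p (j + 2)` lies in S, since otherwise it equals `p' (j + 2)` and `Rel` forbids skipping f.
Then `p' (j + 2)` is at most f, and the successor of f is at most `p (j + 2)`, which is below `p' (j
+ 4)`. -/
theorem passes_forward {j : ℕ} (hj : 1 ≤ j) {f : ℤ} (hf : f ∈ S) (h1 : p j < f)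
    (h2 : f < p (j + 2)) : ∃ g, Adj S f g ∧ p' (j + 2) < g ∧ g < p' (j + 4) := by
  have hR := hS.rel hw hp hp' j hj
  have hR' := hS.rel hw hp hp' (j + 2) (by omega)
  by_cases hmem : p (j + 2) ∈ S
  · obtain ⟨g, hg⟩ := hS.exists_adj_right hf
    have h3 : p' (j + 2) ≤ f := by
      by_contra! h3
      exact hR.notMem f h1 h3 hf
    exact ⟨g, hg, h3.trans_lt hg.lt, (hg.le_of_gt hmem h2).trans_lt hR'.lt⟩
  · have h3 := hS.eq_of_notMem hw hp hp' (by omega) hR' hmem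
    exact absurd hf (hR.notMem f h1 (h3 ▸ h2))

theorem passes_backward {j : ℕ} (hj : 1 ≤ j) (hjn : j ≤ P w) {g : ℤ} (hg : g ∈ S)
    (h1 : p' (j + 2) < g) (h2 : g < p' (j + 4)) : ∃ f, Adj S f g ∧ p j < f ∧ f < p (j + 2) := by
  have hR := hS.rel hw hp hp' j hj
  have hR' := hS.rel hw hp hp' (j + 2) (by omega)
  by_cases hmem : p (j + 2) ∈ S
  · obtain ⟨f, hf⟩ := hS.exists_adj_left hg
    have h3 : g ≤ p (j + 2) := by
      by_contra! h3
      exact hR'.notMem g h3 h2 hg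
    have h4 := (hS.mem_of_mem hw hp' (by omega) (by omega) hR' hmem).1
    exact ⟨f, hf, hR.lt.trans_le (hf.le_of_lt h4 h1), hf.lt.trans_le h3⟩
  · have h3 := hS.eq_of_notMem hw hp hp' (by omega) hR' hmem
    exact absurd hg (hR'.notMem g (h3 ▸ h1) h2)

end IsShift

/-! ### Alternating sums along walks -/

open Classical in
/-- The number of elements of `X` strictly between `u` and `v`. -/
noncomputable def passes (X : Set ℤ) (u v : ℤ) : ℕ := ((Finset.Ioo u v).filter (· ∈ X)).card

/-- The alternating sum of the numbers of elements of `X` that a walk passes. -/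
noncomputable def walkSum (P : ℤ → ℕ) (w : ℤ) (p : ℕ → ℤ) (X : Set ℤ) : ℤ :=
  ∑ j ∈ Finset.range (P w), (-1) ^ (P w - (j + 1)) * (passes X (p (j + 1)) (p (j + 3)) : ℤ)

theorem card_le_of_adj {S : Set ℤ} {s t : Finset ℤ} (h : ∀ f ∈ s, ∃ g ∈ t, Adj S f g) :
    s.card ≤ t.card := by
  choose! F hF hF' using h
  exact Finset.card_le_card_of_injOn F hF fun f hf f' hf' heq =>
    (hF' f hf).left_unique (heq ▸ hF' f' hf')

theorem card_le_of_adj' {S : Set ℤ} {s t : Finset ℤ} (h : ∀ g ∈ t, ∃ f ∈ s, Adj S f g) :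
    t.card ≤ s.card := by
  choose! F hF hF' using h
  exact Finset.card_le_card_of_injOn F hF fun f hf f' hf' heq =>
    (hF' f hf).right_unique (heq ▸ hF' f' hf')

theorem passes_eq_zero {X : Set ℤ} {u v : ℤ} (h : ∀ z, u < z → z < v → z ∉ X) :
    passes X u v = 0 := by
  classical
  rw [passes, Finset.card_eq_zero, Finset.filter_eq_empty_iff]
  intro z hz
  rw [Finset.mem_Ioo] at hz
  exact h z hz.1 hz.2

/-- F is a discrete primitive of the indicator function of X; the correction by 1 appears because
the open interval omits u. -/
theorem exists_counting_function (X : Set ℤ) : ∃ F : ℤ → ℤ, ∀ u v, u < v →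
    (u ∈ X → (passes X u v : ℤ) = F v - F u - 1) ∧ (u ∉ X → (passes X u v : ℤ) = F v - F u) := by
  classical
  let F : ℤ → ℤ := fun z => ((Finset.Ico 0 z).filter (· ∈ X)).card -
    ((Finset.Ico z 0).filter (· ∈ X)).card
  have hF : ∀ z, F (z + 1) - F z = if z ∈ X then 1 else 0 := by
    intro z
    rcases le_or_gt 0 z with hz | hz
    · have h1 : Finset.Ico z 0 = ∅ := Finset.Ico_eq_empty (by omega)
      have h2 : Finset.Ico (z + 1) 0 = ∅ := Finset.Ico_eq_empty (by omega)
      have h3 : Finset.Ico 0 (z + 1) = insert z (Finset.Ico 0 z) := by ext; simp; omega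
      simp only [F, h1, h2, h3, Finset.filter_insert]
      split_ifs <;> simp
    · have h1 : Finset.Ico 0 z = ∅ := Finset.Ico_eq_empty (by omega)
      have h2 : Finset.Ico 0 (z + 1) = ∅ := Finset.Ico_eq_empty (by omega)
      have h3 : Finset.Ico z 0 = insert z (Finset.Ico (z + 1) 0) := by ext; simp; omega
      simp only [F, h1, h2, h3, Finset.filter_insert]
      split_ifs <;> simp
  have key : ∀ u v, u + 1 ≤ v → (passes X u v : ℤ) = F v - F (u + 1) := by
    intro u v huv
    induction v, huv using Int.leInduction with
    | base => simp [passes]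
    | succ v hv ih =>
      have h3 : Finset.Ioo u (v + 1) = insert v (Finset.Ioo u v) := by ext; simp; omega
      have h4 := hF v
      have h5 : (passes X u (v + 1) : ℤ) = passes X u v + if v ∈ X then 1 else 0 := by
        simp only [passes, h3, Finset.filter_insert]
        split_ifs <;> simp
      rw [h5, ih, ← h4]
      ring
  refine ⟨F, fun u v huv => ⟨fun hu => ?_, fun hu => ?_⟩⟩
  · have := hF u
    rw [key u v huv, ← sub_eq_zero]
    simp only [hu, if_true] at this
    linarith
  · have := hF u
    rw [key u v huv]
    simp only [hu, if_false] at this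
    linarith

theorem alternating_telescope (D : ℕ → ℤ) (m : ℕ) :
    ∑ j ∈ Finset.range m, (-1) ^ (m - (j + 1)) * (D (j + 3) - D (j + 1)) =
      D (m + 2) - D (m + 1) + (-1) ^ m * (D 1 - D 2) := by
  induction m with
  | zero => simp
  | succ m ih =>
    have : ∑ j ∈ Finset.range m, (-1) ^ (m + 1 - (j + 1)) * (D (j + 3) - D (j + 1)) =
        -∑ j ∈ Finset.range m, (-1) ^ (m - (j + 1)) * (D (j + 3) - D (j + 1)) := by
      rw [← Finset.sum_neg_distrib]
      refine Finset.sum_congr rfl fun j hj => ?_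
      rw [Finset.mem_range] at hj
      rw [show m + 1 - (j + 1) = (m - (j + 1)) + 1 by omega, pow_succ]
      ring
    rw [Finset.sum_range_succ, this, ih]
    simp only [Nat.sub_self, pow_zero, pow_succ]
    ring

namespace IsShift

variable {e : ℕ} {P P' : ℤ → ℕ} {S : Set ℤ} (hS : IsShift e P P' S) {w w' : ℤ} {p p' : ℕ → ℤ}
include hS

theorem walkSum_of_notMem (hw : w ∉ S) (hp : IsWalk P w p) (hp' : IsWalk P' w p') (X : Set ℤ) :
    walkSum P' w p' X = walkSum P w p X := by
  rw [walkSum, walkSum, hS.off w hw]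
  refine Finset.sum_congr rfl fun j _ => ?_
  rw [(hS.isWalk_of_notMem hw hp).unique hp' _ (by omega),
    (hS.isWalk_of_notMem hw hp).unique hp' _ (by omega)]

theorem walkSum_eq_zero (hw : w ∉ S) (hp : IsWalk P w p) {X : Set ℤ} (hX : X ⊆ S) :
    walkSum P w p X = 0 := by
  refine Finset.sum_eq_zero fun j hj => ?_
  rw [Finset.mem_range] at hj
  rw [passes_eq_zero, Nat.cast_zero, mul_zero]
  exact fun z h1 h2 hz => hw (hS.closed w p hp (j + 1) (by omega) (by omega) z h1 h2 (hX hz))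

variable (hw : Adj S w w') (hp : IsWalk P w p) (hp' : IsWalk P' w' p')
include hw hp hp'

/-- The successor map matches each old term with the new term two degrees higher, and the two lowest
new terms vanish. -/
theorem walkSum_of_subset {X X' : Set ℤ} (hX : X ⊆ S) (hX' : X' ⊆ S)
    (h : ∀ f g, Adj S f g → (f ∈ X ↔ g ∈ X')) : walkSum P' w' p' X' = walkSum P w p X := by
  rw [walkSum, walkSum, hS.on _ _ hw, Finset.sum_range_succ', Finset.sum_range_succ']
  rw [passes_eq_zero (u := p' (0 + 1 + 1)) fun z h1 h2 hz =>
      hS.notMem_of_le_two hw hp hp' (by omega) le_rfl h1 h2 (hX' hz),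
    passes_eq_zero (u := p' (0 + 1)) fun z h1 h2 hz =>
      hS.notMem_of_le_two hw hp hp' (by omega) (by omega) h1 h2 (hX' hz)]
  simp only [Nat.cast_zero, mul_zero, add_zero]
  refine Finset.sum_congr rfl fun j hj => ?_
  rw [Finset.mem_range] at hj
  rw [show P w + 2 - (j + 1 + 1 + 1) = P w - (j + 1) by omega]
  congr 2
  refine le_antisymm (card_le_of_adj' (S := S) fun g hg => ?_)
    (card_le_of_adj (S := S) fun f hf => ?_)
  · simp only [Finset.mem_filter, Finset.mem_Ioo] at hg
    obtain ⟨f, hf, h1, h2⟩ := hS.passes_backward hw hp hp' (j := j + 1) (by omega) (by omega)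
      (hX' hg.2) hg.1.1 hg.1.2
    exact ⟨f, by simpa using ⟨⟨h1, h2⟩, (h f g hf).2 hg.2⟩, hf⟩
  · simp only [Finset.mem_filter, Finset.mem_Ioo] at hf
    obtain ⟨g, hg, h1, h2⟩ := hS.passes_forward hw hp hp' (j := j + 1) (by omega)
      (hX hf.2) hf.1.1 hf.1.2
    exact ⟨g, by simpa using ⟨⟨h1, h2⟩, (h f g hg).1 hf.2⟩, hg⟩

/-- Single terms may differ. With D j = F (p' j) - F (p j) for a counting function F, the difference
of the sums is an alternating sum of D (j + 2) - D j. It telescopes to zero: D vanishes at 1 and 2,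
and beyond the starting indices it is constant. -/
theorem walkSum_of_disjoint {X : Set ℤ} (hX : ∀ z ∈ X, z ∉ S) :
    walkSum P' w' p' X = walkSum P w p X := by
  obtain ⟨F, hF⟩ := exists_counting_function X
  have hP := hS.on _ _ hw
  -- Two empty steps from w to w are appended, so that both sums have the same range.
  have hsum : walkSum P w p X = ∑ j ∈ Finset.range (P w + 2),
      (-1) ^ (P w + 2 - (j + 1)) * (passes X (p (j + 1)) (p (j + 3)) : ℤ) := by
    rw [Finset.sum_range_succ, Finset.sum_range_succ, hp.start (P w + 1) (by omega),
      hp.start (P w + 3) (by omega), hp.start (P w + 1 + 1) (by omega),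
      hp.start (P w + 1 + 3) (by omega), passes_eq_zero (fun z h1 h2 => absurd h2 h1.asymm)]
    simp only [Nat.cast_zero, mul_zero, add_zero]
    refine Finset.sum_congr rfl fun j hj => ?_
    rw [Finset.mem_range] at hj
    rw [show P w + 2 - (j + 1) = (P w - (j + 1)) + 2 by omega, pow_add]
    simp
  rw [hsum, walkSum, hP, ← sub_eq_zero, ← Finset.sum_sub_distrib]
  have hterm : ∀ j ∈ Finset.range (P w + 2),
      (-1) ^ (P w + 2 - (j + 1)) * (passes X (p' (j + 1)) (p' (j + 3)) : ℤ) -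
        (-1) ^ (P w + 2 - (j + 1)) * (passes X (p (j + 1)) (p (j + 3)) : ℤ) =
      (-1) ^ (P w + 2 - (j + 1)) *
        ((F (p' (j + 3)) - F (p (j + 3))) - (F (p' (j + 1)) - F (p (j + 1)))) := by
    intro j hj
    rw [Finset.mem_range] at hj
    rw [← mul_sub]
    congr 1
    have hR := hS.rel hw hp hp' (j + 1) (by omega)
    have hF' := hF _ _ (hp'.lt (j + 1) (by omega) (by omega))
    have hFp : (p (j + 1) ∈ X → (passes X (p (j + 1)) (p (j + 3)) : ℤ) =
        F (p (j + 3)) - F (p (j + 1)) - 1) ∧ (p (j + 1) ∉ X →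
        (passes X (p (j + 1)) (p (j + 3)) : ℤ) = F (p (j + 3)) - F (p (j + 1))) := by
      by_cases hj' : j + 1 ≤ P w
      · exact hF _ _ (hp.lt (j + 1) (by omega) hj')
      · rw [hp.start (j + 1) (by omega), hp.start (j + 3) (by omega),
          passes_eq_zero (fun z h1 h2 => absurd h2 h1.asymm)]
        exact ⟨fun h => absurd hw.left (hX _ h), fun _ => by simp⟩
    have hiff : p' (j + 1) ∈ X ↔ p (j + 1) ∈ X := by
      by_cases hmem : p (j + 1) ∈ S
      · have := (hS.mem_of_mem hw hp' (by omega) (by omega) hR hmem).1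
        exact ⟨fun h => absurd this (hX _ h), fun h => absurd hmem (hX _ h)⟩
      · rw [hS.eq_of_notMem hw hp hp' (by omega) hR hmem]
    by_cases hx : p (j + 1) ∈ X
    · rw [hF'.1 (hiff.2 hx), hFp.1 hx]; ring
    · rw [hF'.2 (fun h => hx (hiff.1 h)), hFp.2 hx]; ring
  rw [Finset.sum_congr rfl hterm,
    alternating_telescope (fun j => F (p' j) - F (p j)) (P w + 2),
    hS.eq_of_le_two hw hp hp' (j := 1) le_rfl (by omega),
    hS.eq_of_le_two hw hp hp' (j := 2) (by omega) le_rfl,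
    hp.start (P w + 2 + 2) (by omega), hp.start (P w + 2 + 1) (by omega),
    hp'.start (P w + 2 + 2) (by omega), hp'.start (P w + 2 + 1) (by omega)]
  ring

end IsShift

/-! ### Homology of chain complexes of modules -/

/-- For j = 0 the truncated index j - 1 is 0 and `X.d 0 0` vanishes, so the formula includes degree
0. -/
theorem homology_equiv {A : Type u} [Ring A] (X : ChainComplex (ModuleCat.{u} A) ℕ) (j : ℕ) :
    Nonempty (X.homology j ≃ₗ[A] LinearMap.ker (X.d j (j - 1)).hom ⧸
      (LinearMap.range (X.d (j + 1) j).hom).submoduleOf (LinearMap.ker (X.d j (j - 1)).hom)) := by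
  have hnext : (ComplexShape.down ℕ).next j = j - 1 := by
    cases j with
    | zero => exact ChainComplex.next_nat_zero
    | succ j => exact ChainComplex.next_nat_succ j
  have e₁ := ShortComplex.homologyMapIso
    (X.isoSc' (j + 1) j (j - 1) (ChainComplex.prev ℕ j) hnext)
  have e₂ := (X.sc' (j + 1) j (j - 1)).moduleCatHomologyIso
  have e₃ : X.homology j ≃ₗ[A] LinearMap.ker (X.d j (j - 1)).hom ⧸
      LinearMap.range (X.sc' (j + 1) j (j - 1)).moduleCatToCycles := (e₁ ≪≫ e₂).toLinearEquiv
  refine ⟨e₃.trans (Submodule.quotEquivOfEq _ _ ?_)⟩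
  ext x
  simp only [LinearMap.mem_range, Submodule.submoduleOf]
  exact ⟨fun ⟨y, hy⟩ => ⟨y, congrArg Subtype.val hy⟩, fun ⟨y, hy⟩ => ⟨y, Subtype.ext hy⟩⟩

section

variable {A : Type u} [Ring A] {ι : Type} {T : ι → ModuleCat.{u} A} {lab : ℤ → ι} {M : Type u}
  [AddCommGroup M] [Module A M] {c : ℤ} {q : ℕ} {N : ℕ → Submodule A M}

theorem IsUniserial.isGreatest (hT : ∀ i j, Nonempty (T i ≃ₗ[A] T j) → i = j)
    (h : IsUniserial T lab M c q N) {π : ι → ℕ} {j r v : ℕ} (hrv : r ≤ v) (hv : v ≤ q)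
    (h₁ : ∀ s, r ≤ s → s < v → π (lab (c - s)) < j) (h₂ : j ≤ π (lab (c - v))) :
    IsGreatest {W : Submodule A M | N r ≤ W ∧ FactorsIn T {α | π α < j} (W ⧸ (N r).submoduleOf W)}
      (N v) := by
  constructor
  · refine ⟨h.mono hrv hv, ?_⟩
    obtain ⟨N', h'⟩ := h.subquotient hrv hv
    rw [h'.factorsIn_iff hT]
    intro s hs
    have := h₁ (r + s) (by omega) (by omega)
    rwa [show c - ((r + s : ℕ) : ℤ) = c - r - s by push_cast; ring] at this
  · rintro W ⟨hrW, hW⟩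
    obtain ⟨t, ht, rfl⟩ := h.exists_eq W
    have hrt := (h.le_iff (hrv.trans hv) ht).1 hrW
    refine h.mono ?_ hv
    by_contra! hvt
    obtain ⟨N', h'⟩ := h.subquotient hrt ht
    rw [h'.factorsIn_iff hT] at hW
    have := hW (v - r) (by omega)
    rw [show c - (r : ℤ) - ((v - r : ℕ) : ℤ) = c - v by omega] at this
    exact absurd this (not_lt.2 h₂)

theorem IsUniserial.isEssential (h : IsUniserial T lab M c q N) {r : ℕ} (hr : 0 < r)
    (hrq : r ≤ q) : IsEssential (N r) := by
  intro W hW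
  obtain ⟨s, hs, rfl⟩ := h.exists_eq W
  rcases Nat.eq_zero_or_pos s with rfl | hpos
  · exact h.bot
  · exfalso
    have h1 : N 1 ≤ ⊥ := hW ▸ le_inf (h.mono hpos hs) (h.mono hr hrq)
    have h2 := h.lt 0 (by omega)
    rw [h.bot] at h2
    exact h2.not_ge h1

theorem IsUniserial.of_zero [Subsingleton M] : IsUniserial T lab M c 0 fun _ => ⊥ where
  bot := rfl
  top := Subsingleton.elim _ _
  lt s hs := absurd hs (Nat.not_lt_zero s)
  factor s hs := absurd hs (Nat.not_lt_zero s)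
  exists_eq _ := ⟨0, le_rfl, Subsingleton.elim _ _⟩

theorem IsUniserial.range (h : IsUniserial T lab M c q N) {M' : Type u} [AddCommGroup M']
    [Module A M'] (f : M →ₗ[A] M') {v : ℕ} (hv : v ≤ q) (hf : LinearMap.ker f = N v) :
    ∃ N', IsUniserial T lab (LinearMap.range f) (c - v) (q - v) N' :=
  ⟨_, (h.quotient hv).map
    ((Submodule.quotEquivOfEq _ _ hf.symm).trans f.quotKerEquivRange)⟩

/-- The top t factors of `M` and the bottom t factors of `M'` carry the same labels, so these two
uniserial modules are isomorphic; `P` serves to compare them. For t = 0 the zero map needs no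
condition on labels. -/
theorem IsUniserial.exists_hom {M' P : Type u} [AddCommGroup M'] [Module A M'] [AddCommGroup P]
    [Module A P] [Module.Injective A P] {c' : ℤ} {m m' t b : ℕ} {N' : ℕ → Submodule A M'}
    {K : ℕ → Submodule A P} (h : IsUniserial T lab M c m N) (h' : IsUniserial T lab M' c' m' N')
    (hP : IsUniserial T lab P c' b K) (hb : 0 < b) (ht : t ≤ m) (ht' : t ≤ m')
    (hc : 0 < t → ∀ s : ℕ, lab (c - (m - t : ℕ) - s) = lab (c' - s)) :
    ∃ f : M →ₗ[A] M', LinearMap.ker f = N (m - t) ∧ LinearMap.range f = N' t := by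
  rcases Nat.eq_zero_or_pos t with rfl | htpos
  · exact ⟨0, by rw [LinearMap.ker_zero, Nat.sub_zero, h.top], by rw [LinearMap.range_zero, h'.bot]⟩
  have h1 := (h.quotient (Nat.sub_le m t)).congr_label (hc htpos)
  rw [Nat.sub_sub_self ht] at h1
  obtain ⟨g⟩ := h1.nonempty_equiv (h'.submodule ht') hP hb
  refine ⟨(N' t).subtype.comp (g.toLinearMap.comp (N (m - t)).mkQ), ?_, ?_⟩
  · rw [LinearMap.ker_comp_of_ker_eq_bot _ (Submodule.ker_subtype _), LinearEquiv.ker_comp,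
      Submodule.ker_mkQ]
  · rw [LinearMap.range_comp, LinearMap.range_comp, Submodule.range_mkQ, Submodule.map_top,
      LinearEquiv.range, Submodule.map_top, Submodule.range_subtype]

end

/-! ### Lengths and labels along a walk. -/

/-- The length of the module `L_j`. -/
def stepLength (q : ℕ) (P : ℤ → ℕ) (w : ℤ) (p : ℕ → ℤ) (j : ℕ) : ℕ :=
  ((if Even (P w + 1 - j) then 1 else q : ℤ) + p j - p (j + 1)).toNat

namespace Datum

variable {e : ℕ} [NeZero e] (D : Datum.{u} e) {π : Fin e → ℕ} {w : ℤ} {p : ℕ → ℤ}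

theorem residue_periodic (z t : ℤ) : residue e (z + t * e) = residue e z := by
  rw [residue_eq_iff, Int.add_mul_emod_self_right]

/-- The perversity function on the integer line. -/
abbrev lift (π : Fin e → ℕ) : ℤ → ℕ := fun z => π (residue e z)

/-- Since q ≡ 1 modulo e, the lengths 1 + p j - p (j + 1) and q + p j - p (j + 1) lead to the same
top label. -/
theorem residue_sub_q (z : ℤ) : residue e (z - D.q) = residue e (z - 1) := by
  obtain ⟨m, -, hm⟩ := D.q_sub_one
  rw [hm, ← residue_periodic (z - 1) (-m)]
  congr 1
  push_cast
  ring

section Lengths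

variable (hp : IsWalk (lift π) w p)
include hp

local notation "len" => stepLength D.q (lift π) w p

/-- By `IsWalk.bounds` and q ≥ e + 1 the integer lies between 1 and q. So `toNat` loses nothing and
no L_j is zero. -/
theorem stepLength_spec {j : ℕ} (hj : 1 ≤ j) (hjn : j ≤ lift π w + 1) :
    (len j : ℤ) = (if Even (lift π w + 1 - j) then 1 else D.q : ℤ) + p j - p (j + 1) ∧
      1 ≤ len j ∧ len j ≤ D.q := by
  have hb := hp.bounds (Nat.pos_of_neZero e) (fun z t => by simp only [lift, residue_periodic])
    j hj hjn
  obtain ⟨m, hm, hq⟩ := D.q_sub_one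
  have hle : e ≤ m * e := Nat.le_mul_of_pos_left e hm
  rw [stepLength]
  split_ifs with heven
  · have := hb.1 heven
    have he : (e : ℤ) ≤ D.q := by exact_mod_cast (by omega : e ≤ D.q)
    omega
  · have := hb.2 heven
    have he : (e : ℤ) + 1 ≤ D.q := by exact_mod_cast (by omega : e + 1 ≤ D.q)
    omega

/-- From the socle upwards, P_j is built from L_{j+1}, the skipped positions and L_j. -/
theorem stepLength_add {j : ℕ} (hj : 1 ≤ j) (hjn : j ≤ lift π w) :
    (len j : ℤ) + len (j + 1) + (p (j + 2) - p j - 1) = D.q := by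
  have h1 := (D.stepLength_spec hp hj (by omega)).1
  have h2 := (D.stepLength_spec hp (j := j + 1) (by omega) (by omega)).1
  have hpar : Even (lift π w + 1 - j) ↔ ¬ Even (lift π w + 1 - (j + 1)) := by
    rw [show lift π w + 1 - j = (lift π w + 1 - (j + 1)) + 1 by omega, Nat.even_add_one]
  rw [h1, h2]
  simp only [add_assoc, Nat.reduceAdd]
  by_cases h : Even (lift π w + 1 - j)
  · rw [if_pos h, if_neg (hpar.1 h)]; ring
  · rw [if_neg h, if_pos (by tauto)]; ring

theorem stepLength_succ_le {j : ℕ} (hj : 1 ≤ j) (hjn : j ≤ lift π w) :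
    len (j + 1) ≤ D.q - len j := by
  have h1 := D.stepLength_add hp hj hjn
  have h2 := hp.lt j hj hjn
  omega

theorem residue_sub_stepLength {j : ℕ} (hj : 1 ≤ j) (hjn : j ≤ lift π w + 1) (s : ℤ) :
    residue e (p j - len j - s) = residue e (p (j + 1) - 1 - s) := by
  rw [(D.stepLength_spec hp hj hjn).1]
  split_ifs
  · congr 1; ring
  · have h := D.residue_sub_q (p (j + 1) - s)
    convert h using 2 <;> ring

theorem residue_sub_colength {j : ℕ} (hj : 1 ≤ j) (hjn : j ≤ lift π w + 1) (s : ℤ) :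
    residue e (p (j + 1) - (D.q - len j : ℕ) - s) = residue e (p j - s) := by
  obtain ⟨h1, -, h2⟩ := D.stepLength_spec hp hj hjn
  rw [Nat.cast_sub h2, h1]
  split_ifs
  · have h := D.residue_sub_q (p j - s + 1)
    convert h using 2 <;> ring
  · congr 1; ring

theorem residue_pred_of_lt {j : ℕ} (hj : 1 ≤ j) (hjn : j ≤ lift π w) (s : ℕ)
    (h₁ : len (j + 1) ≤ s) (h₂ : s < D.q - len j) : π (residue e (p (j + 1) - s)) < j := by
  have h3 := D.residue_sub_stepLength hp (j := j + 1) (by omega) (by omega)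
    ((s - len (j + 1) : ℕ) : ℤ)
  rw [show p (j + 1) - len (j + 1) - ((s - len (j + 1) : ℕ) : ℤ) = p (j + 1) - s by omega] at h3
  rw [h3]
  have h4 := D.stepLength_add hp hj hjn
  exact hp.skip j hj hjn _ (by simp only [add_assoc, Nat.reduceAdd]; omega)
    (by simp only [add_assoc, Nat.reduceAdd]; omega)

theorem le_residue_colength {j : ℕ} (hj : 1 ≤ j) (hjn : j ≤ lift π w) :
    j ≤ π (residue e (p (j + 1) - (D.q - len j : ℕ))) := by
  have h := D.residue_sub_colength hp hj (by omega) 0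
  rw [sub_zero, sub_zero] at h
  rw [h]
  exact hp.le j hj hjn

theorem isGreatest_of_isUniserial {M : Type u} [AddCommGroup M] [Module D.Alg M]
    {N : ℕ → Submodule D.Alg M} {j : ℕ} (hj : 1 ≤ j) (hjn : j ≤ lift π w)
    (h : IsUniserial D.T (residue e) M (p (j + 1)) D.q N) :
    IsGreatest {W : Submodule D.Alg M | N (len (j + 1)) ≤ W ∧
      FactorsIn D.T {α | π α < j} (W ⧸ (N (len (j + 1))).submoduleOf W)} (N (D.q - len j)) :=
  h.isGreatest D.T_injective (D.stepLength_succ_le hp hj hjn) (Nat.sub_le _ _)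
    (D.residue_pred_of_lt hp hj hjn) (D.le_residue_colength hp hj hjn)

end Lengths

/-! ### The structure of the output -/

theorem exists_isUniserial_T (c : ℤ) :
    ∃ N, IsUniserial D.T (residue e) (D.T (residue e c)) c 1 N := by
  obtain ⟨P, -, K, hK⟩ := D.exists_injective_isUniserial c
  have hq := Nat.pos_of_neZero D.q
  obtain ⟨g⟩ := hK.equiv_one hq
  exact ⟨_, (hK.submodule hq).map g⟩

theorem isUniserial_of_isStep (hp : IsWalk (lift π) w p) {X : ChainComplex (ModuleCat.{u} D.Alg) ℕ}
    {j : ℕ} (hj : 1 ≤ j) (hjn : j ≤ lift π w) {B : Submodule D.Alg (X.X j)}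
    (h : IsStep D.T π X j B) {N : ℕ → Submodule D.Alg B}
    (hB : IsUniserial D.T (residue e) B (p (j + 1)) (stepLength D.q (lift π) w p (j + 1)) N) :
    ∃ K, IsUniserial D.T (residue e) (X.X j) (p (j + 1)) D.q K ∧
      B = K (stepLength D.q (lift π) w p (j + 1)) ∧
      LinearMap.ker (X.d j (j - 1)).hom = K (D.q - stepLength D.q (lift π) w p j) := by
  obtain ⟨P, hP, K, hK⟩ := D.exists_injective_isUniserial (p (j + 1))
  have hinj : Module.Injective D.Alg (X.X j) := by
    have := h.injective
    exact Module.injective_module_of_injective_object _ _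
  have hlen := (D.stepLength_spec hp (j := j + 1) (by omega) (by omega)).2.1
  obtain ⟨K', hK', -, hBK⟩ := hB.of_essential h.essential hlen hK (Nat.pos_of_neZero D.q)
  refine ⟨K', hK', hBK, ?_⟩
  have h1 := h.ker_isGreatest
  subst hBK
  exact h1.unique (D.isGreatest_of_isUniserial hp hj hjn hK')

/-- The range of the differential that starts in degree `j`. -/
theorem isUniserial_range (hp : IsWalk (lift π) w p) {M M' : Type u} [AddCommGroup M]
    [Module D.Alg M] [AddCommGroup M'] [Module D.Alg M'] (f : M →ₗ[D.Alg] M')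
    {j : ℕ} (hj : 1 ≤ j) (hjn : j ≤ lift π w) {K : ℕ → Submodule D.Alg M}
    (hK : IsUniserial D.T (residue e) M (p (j + 1)) D.q K)
    (hf : LinearMap.ker f = K (D.q - stepLength D.q (lift π) w p j)) :
    ∃ N, IsUniserial D.T (residue e) (LinearMap.range f) (p j)
      (stepLength D.q (lift π) w p j) N := by
  obtain ⟨N, hN⟩ := hK.range f (Nat.sub_le _ _) hf
  rw [Nat.sub_sub_self (D.stepLength_spec hp hj (by omega)).2.2] at hN
  exact ⟨N, hN.congr_label fun s => D.residue_sub_colength hp hj (by omega) s⟩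

/-- The uniserial image from the degree above determines its injective hull, and then the kernel and
the next image. In the starting degree a copy of T_i replaces the incoming image, hence the
condition on the range. -/
theorem output_isUniserial (hp : IsWalk (lift π) w p)
    {X : ChainComplex (ModuleCat.{u} D.Alg) ℕ} (hX : D.Output π (residue e w) X) (j : ℕ)
    (hj : 1 ≤ j) : j ≤ lift π w →
      ∃ K, IsUniserial D.T (residue e) (X.X j) (p (j + 1)) D.q K ∧
        (j < lift π w → LinearMap.range (X.d (j + 1) j).hom =
          K (stepLength D.q (lift π) w p (j + 1))) ∧
        LinearMap.ker (X.d j (j - 1)).hom = K (D.q - stepLength D.q (lift π) w p j) := by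
  refine downward_induction (n := lift π w) (Q := fun j => j ≤ lift π w →
      ∃ K, IsUniserial D.T (residue e) (X.X j) (p (j + 1)) D.q K ∧
        (j < lift π w → LinearMap.range (X.d (j + 1) j).hom =
          K (stepLength D.q (lift π) w p (j + 1))) ∧
        LinearMap.ker (X.d j (j - 1)).hom = K (D.q - stepLength D.q (lift π) w p j))
    (fun j hj hjn => absurd hjn (not_le.2 hj)) (fun j hj hjn ih _ _ => ?_) j hj
  rcases hjn.eq_or_lt with rfl | hlt
  · obtain ⟨S, ⟨g⟩, hS⟩ := hX.first hj
    obtain ⟨N, hN⟩ := D.exists_isUniserial_T w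
    have hlen := (D.stepLength_spec hp (j := lift π w + 1) (by omega) le_rfl).1
    have hw := hp.start (lift π w + 1) (by omega)
    rw [hp.start _ (by omega), hp.start _ (by omega)] at hlen
    have hlen' : stepLength D.q (lift π) w p (lift π w + 1) = 1 := by
      simpa using hlen
    obtain ⟨N', hN'⟩ : ∃ N', IsUniserial D.T (residue e) S (p (lift π w + 1))
        (stepLength D.q (lift π) w p (lift π w + 1)) N' := by
      rw [hw, hlen']
      exact ⟨_, hN.map g.symm⟩
    obtain ⟨K, h1, h2, h3⟩ := D.isUniserial_of_isStep hp hj hjn hS hN'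
    exact ⟨K, h1, fun h => absurd h (lt_irrefl _), h3⟩
  · obtain ⟨K, h1, -, h3⟩ := ih hlt
    rw [Nat.add_sub_cancel] at h3
    obtain ⟨N, hN⟩ := D.isUniserial_range hp _ (Nat.le_add_left 1 j) hlt h1 h3
    obtain ⟨K', h1', h2', h3'⟩ := D.isUniserial_of_isStep hp hj hjn (hX.next j (by omega) hlt) hN
    exact ⟨K', h1', fun _ => h2', h3'⟩

theorem output_zero_isUniserial (hp : IsWalk (lift π) w p)
    {X : ChainComplex (ModuleCat.{u} D.Alg) ℕ} (hX : D.Output π (residue e w) X) :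
    ∃ K, IsUniserial D.T (residue e) (X.X 0) (p 1) (stepLength D.q (lift π) w p 1) K := by
  rcases Nat.eq_zero_or_pos (lift π w) with h0 | hpos
  · obtain ⟨g⟩ := hX.of_eq_zero h0
    obtain ⟨N, hN⟩ := D.exists_isUniserial_T w
    have h1 := hp.start 1 (by omega)
    have hlen := (D.stepLength_spec hp (j := 1) le_rfl (by omega)).1
    rw [hp.start 1 (by omega), hp.start _ (by omega)] at hlen
    have hlen' : stepLength D.q (lift π) w p 1 = 1 := by
      simpa [h0] using hlen
    rw [h1, hlen']
    exact ⟨_, hN.map g.toLinearEquiv.symm⟩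
  · obtain ⟨K, h1, -, h3⟩ := D.output_isUniserial hp hX 1 le_rfl hpos
    obtain ⟨N, hN⟩ := D.isUniserial_range hp _ le_rfl hpos h1 h3
    exact ⟨_, hN.map (LinearEquiv.ofTop _ (LinearMap.range_eq_top.2 (hX.last hpos)))⟩

theorem output_hasSocleTop (hp : IsWalk (lift π) w p)
    {X : ChainComplex (ModuleCat.{u} D.Alg) ℕ} (hX : D.Output π (residue e w) X) :
    HasSocleTop D.T (X.X 0) (residue e (p 1)) (residue e (p 2)) := by
  obtain ⟨K, hK⟩ := D.output_zero_isUniserial hp hX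
  have h := hK.hasSocleTop (D.stepLength_spec hp le_rfl (by omega)).2.1
  have h1 := D.residue_sub_stepLength hp (j := 1) le_rfl (by omega) (-1)
  rw [sub_neg_eq_add, sub_neg_eq_add, sub_add_cancel] at h1
  rwa [h1] at h

/-- The homology in positive degrees: its composition factors are labelled by the positions that
the walk passes, and in the degree where the complex starts also by `w` itself. -/
theorem output_homology_isUniserial (hp : IsWalk (lift π) w p)
    {X : ChainComplex (ModuleCat.{u} D.Alg) ℕ} (hX : D.Output π (residue e w) X) {j : ℕ}
    (hj : 1 ≤ j) (hjn : j ≤ lift π w) :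
    ∃ (v : ℤ) (r : ℕ) (N : _), v = (if j = lift π w then w + 1 else p (j + 2)) ∧
      (r : ℤ) = v - 1 - p j ∧ IsUniserial D.T (residue e) (X.homology j) (v - 1) r N := by
  obtain ⟨K, h1, h2, h3⟩ := D.output_isUniserial hp hX j hj hjn
  obtain ⟨g⟩ := homology_equiv X j
  have hadd := D.stepLength_add hp hj hjn
  have hle := D.stepLength_succ_le hp hj hjn
  rw [h3] at g
  rcases hjn.eq_or_lt with rfl | hlt
  · have hrange : LinearMap.range (X.d (lift π w + 1) (lift π w)).hom = K 0 := by
      rw [h1.bot, (hX.isZero (lift π w + 1) (Nat.lt_succ_self _)).eq_of_src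
        (X.d (lift π w + 1) (lift π w)) 0]
      exact LinearMap.range_zero
    rw [hrange] at g
    obtain ⟨N, hN⟩ := h1.subquotient (Nat.zero_le _) (Nat.sub_le _ _)
    have h4 := hp.start (lift π w + 1) (by omega)
    have h5 := (D.stepLength_spec hp hj (by omega)).1
    have h6 := (D.stepLength_spec hp hj (by omega)).2.2
    rw [if_neg (by simp), h4] at h5
    have h7 := hN.map g.symm
    refine ⟨_, _, _, rfl, ?_, h7.congr_label fun s => ?_⟩
    · rw [if_pos rfl]; omega
    · rw [if_pos rfl, h4]; simp
  · rw [h2 hlt] at g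
    obtain ⟨N, hN⟩ := h1.subquotient hle (Nat.sub_le _ _)
    refine ⟨_, _, _, rfl, ?_, (hN.map g.symm).congr_label fun s => ?_⟩
    · have := (D.stepLength_spec hp hj (by omega)).2.2
      rw [if_neg hlt.ne]; omega
    · rw [if_neg hlt.ne]
      exact D.residue_sub_stepLength hp (j := j + 1) (by omega) (by omega) s

/-- The last differential is onto, so degree 0 contributes only when the complex is T_i itself. -/
theorem output_homology_zero (hp : IsWalk (lift π) w p)
    {X : ChainComplex (ModuleCat.{u} D.Alg) ℕ} (hX : D.Output π (residue e w) X) :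
    ∃ N, IsUniserial D.T (residue e) (X.homology 0) w (if lift π w = 0 then 1 else 0) N := by
  obtain ⟨K, hK⟩ := D.output_zero_isUniserial hp hX
  obtain ⟨g⟩ := homology_equiv X 0
  have hker : LinearMap.ker (X.d 0 (0 - 1)).hom = K (stepLength D.q (lift π) w p 1) := by
    rw [hK.top, X.shape 0 (0 - 1) (by simp)]
    exact LinearMap.ker_zero
  rw [hker] at g
  split_ifs with h0
  · have hrange : LinearMap.range (X.d (0 + 1) 0).hom = K 0 := by
      rw [hK.bot, (hX.isZero (0 + 1) (by change lift π w < _; omega)).eq_of_src (X.d (0 + 1) 0) 0]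
      exact LinearMap.range_zero
    rw [hrange] at g
    obtain ⟨N, hN⟩ := hK.subquotient (Nat.zero_le _) le_rfl
    have h1 := hp.start 1 (by omega)
    have hlen := (D.stepLength_spec hp (j := 1) le_rfl (by omega)).1
    rw [hp.start 1 (by omega), hp.start _ (by omega)] at hlen
    have hlen' : stepLength D.q (lift π) w p 1 = 1 := by
      simpa [h0] using hlen
    obtain ⟨N', h2⟩ : ∃ N', IsUniserial D.T (residue e) (X.homology 0) (p 1 - (0 : ℕ))
      (stepLength D.q (lift π) w p 1 - 0) N' := ⟨_, hN.map g.symm⟩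
    rw [hlen', h1, Nat.cast_zero, sub_zero] at h2
    exact ⟨N', h2⟩
  · have hrange : LinearMap.range (X.d (0 + 1) 0).hom = K (stepLength D.q (lift π) w p 1) := by
      rw [hK.top]
      exact LinearMap.range_eq_top.2 (hX.last (Nat.pos_of_ne_zero h0))
    rw [hrange] at g
    obtain ⟨N, hN⟩ := hK.subquotient le_rfl le_rfl
    have h2 := hN.map g.symm
    rw [Nat.sub_self] at h2
    have : Subsingleton (X.homology 0) := by
      rw [← Submodule.subsingleton_iff D.Alg, ← subsingleton_iff_bot_eq_top, ← h2.top, h2.bot]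
    exact ⟨_, IsUniserial.of_zero⟩

theorem card_filter_range_eq_passes (x : Fin e) {u v : ℤ} {r : ℕ} (hr : (r : ℤ) = v - 1 - u) :
    ((Finset.range r).filter fun s : ℕ => residue e (v - 1 - s) = x).card =
      passes {z | residue e z = x} u v := by
  classical
  rw [passes]
  refine Finset.card_bij' (fun s _ => v - 1 - s) (fun z _ => (v - 1 - z).toNat) ?_ ?_ ?_ ?_
  · intro s hs
    simp only [Finset.mem_filter, Finset.mem_range, Finset.mem_Ioo, Set.mem_ofPred_eq] at *
    exact ⟨by omega, hs.2⟩
  · intro z hz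
    simp only [Finset.mem_filter, Finset.mem_range, Finset.mem_Ioo, Set.mem_ofPred_eq] at *
    refine ⟨by omega, ?_⟩
    rw [← hz.2]
    congr 1
    omega
  · intro s _
    simp
  · intro z hz
    simp only [Finset.mem_filter, Finset.mem_Ioo] at hz
    omega

theorem passes_succ (x : Fin e) {u : ℤ} (huw : u < w) :
    passes {z | residue e z = x} u (w + 1) =
      passes {z | residue e z = x} u w + if residue e w = x then 1 else 0 := by
  classical
  have h : Finset.Ioo u (w + 1) = insert w (Finset.Ioo u w) := by ext; simp; omega
  simp only [passes, h, Finset.filter_insert, Set.mem_ofPred_eq]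
  split_ifs <;> simp

/-- The additional summand is T_i in the starting degree, where the sign is +1. -/
theorem output_altSum (hp : IsWalk (lift π) w p)
    {X : ChainComplex (ModuleCat.{u} D.Alg) ℕ} (hX : D.Output π (residue e w) X) (x : Fin e) :
    altSum D.T π (residue e w) X x =
      walkSum (lift π) w p {z | residue e z = x} + if residue e w = x then 1 else 0 := by
  have hmult : ∀ j, 1 ≤ j → j ≤ lift π w → (multiplicity (D.T x) (X.homology j) : ℤ) =
      passes {z | residue e z = x} (p j) (p (j + 2)) +
        if j = lift π w then (if residue e w = x then 1 else 0) else 0 := by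
    intro j hj hjn
    obtain ⟨v, r, N, hv, hr, hN⟩ := D.output_homology_isUniserial hp hX hj hjn
    rw [hN.multiplicity_eq_card D.T_injective, card_filter_range_eq_passes x hr, hv]
    split_ifs with h1 h2
    · have hlt := hp.lt j hj hjn
      rw [hp.start (j + 2) (by omega)] at hlt ⊢
      rw [passes_succ x hlt, if_pos h2]
      simp
    · have hlt := hp.lt j hj hjn
      rw [hp.start (j + 2) (by omega)] at hlt ⊢
      rw [passes_succ x hlt, if_neg h2]
      simp
    · simp
  have hmult0 : (multiplicity (D.T x) (X.homology 0) : ℤ) =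
      if lift π w = 0 then (if residue e w = x then 1 else 0) else 0 := by
    obtain ⟨N, hN⟩ := D.output_homology_zero hp hX
    rw [hN.multiplicity_eq_card D.T_injective]
    by_cases h1 : lift π w = 0 <;> by_cases h2 : residue e w = x <;>
      simp [h1, h2, Finset.filter_singleton]
  rw [altSum, walkSum, Finset.sum_range_succ', hmult0]
  change ∑ j ∈ Finset.range (lift π w), (-1) ^ (lift π w - (j + 1)) *
    (multiplicity (D.T x) (X.homology (j + 1)) : ℤ) + (-1) ^ (lift π w - 0) * _ = _
  have hsum : ∀ j ∈ Finset.range (lift π w), (-1) ^ (lift π w - (j + 1)) *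
      (multiplicity (D.T x) (X.homology (j + 1)) : ℤ) = (-1) ^ (lift π w - (j + 1)) *
        (passes {z | residue e z = x} (p (j + 1)) (p (j + 3)) : ℤ) +
        if j = lift π w - 1 then (if residue e w = x then 1 else 0) else 0 := by
    intro j hj
    rw [Finset.mem_range] at hj
    rw [hmult (j + 1) (by omega) (by omega), mul_add]
    by_cases h : j + 1 = lift π w
    · rw [if_pos h, if_pos (show j = lift π w - 1 by omega),
        show lift π w - (j + 1) = 0 by omega, pow_zero, one_mul, one_mul]
    · rw [if_neg h, if_neg (show ¬ j = lift π w - 1 by omega), mul_zero]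
  rw [Finset.sum_congr rfl hsum, Finset.sum_add_distrib, add_assoc]
  congr 1
  rw [Finset.sum_ite_eq']
  by_cases h : lift π w = 0
  · simp [h]
  · rw [if_pos (by rw [Finset.mem_range]; omega), if_neg h, mul_zero, add_zero]

theorem output_isCompositionFactor_iff (hp : IsWalk (lift π) w p)
    {X : ChainComplex (ModuleCat.{u} D.Alg) ℕ} (hX : D.Output π (residue e w) X) {j : ℕ}
    (hj : 1 ≤ j) (hjn : j ≤ lift π w) (x : Fin e) :
    IsCompositionFactor (D.T x) (X.homology j) ↔
      (∃ z, p j < z ∧ z < p (j + 2) ∧ residue e z = x) ∨ (j = lift π w ∧ residue e w = x) := by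
  obtain ⟨v, r, N, hv, hr, hN⟩ := D.output_homology_isUniserial hp hX hj hjn
  rw [hN.isCompositionFactor_iff D.T_injective]
  have hlt := hp.lt j hj hjn
  have h2 : j = lift π w → p (j + 2) = w := fun h => hp.start _ (by omega)
  constructor
  · rintro ⟨s, hs, hx⟩
    by_cases h : j = lift π w
    · rw [if_pos h] at hv
      by_cases hs0 : s = 0
      · right
        rw [hv, hs0] at hx
        exact ⟨h, by simpa using hx⟩
      · left
        have := h2 h
        exact ⟨_, by omega, by omega, hx⟩
    · rw [if_neg h] at hv
      left
      exact ⟨_, by omega, by omega, hx⟩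
  · rintro (⟨z, hz, hz', hx⟩ | ⟨h, hx⟩)
    · have hzv : z < v := by
        by_cases h : j = lift π w
        · rw [if_pos h] at hv
          have := h2 h
          omega
        · rw [if_neg h] at hv
          omega
      refine ⟨(v - 1 - z).toNat, by omega, ?_⟩
      rw [← hx]
      congr 1
      omega
    · rw [if_pos h] at hv
      have := h2 h
      exact ⟨0, by omega, by rw [hv]; simpa using hx⟩

/-! ### Existence of the output -/

theorem exists_isUniserial (c : ℤ) {m : ℕ} (hm : m ≤ D.q) :
    ∃ (Y : ModuleCat.{u} D.Alg) (N : _), IsUniserial D.T (residue e) Y c m N ∧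
      (m = D.q → Module.Injective D.Alg Y) := by
  obtain ⟨P, hP, K, hK⟩ := D.exists_injective_isUniserial c
  rcases hm.eq_or_lt with rfl | hlt
  · exact ⟨P, K, hK, fun _ => hP⟩
  · exact ⟨ModuleCat.of _ (K m), _, hK.submodule hm, fun h => absurd h hlt.ne⟩

theorem exists_output (hp : IsWalk (lift π) w p) : ∃ X, D.Output π (residue e w) X := by
  set n := lift π w with hn
  set r := stepLength D.q (lift π) w p with hr
  -- `m j` is the length of the term in degree j, and `t j` the length of the image of the
  -- differential into it. The image is zero from degree n on, the term only above n.
  let m : ℕ → ℕ := fun j => if j = 0 then r 1 else if j ≤ n then D.q else 0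
  let t : ℕ → ℕ := fun j => if j + 1 ≤ n then r (j + 1) else 0
  have hr1 : ∀ j, 1 ≤ j → j ≤ n + 1 → 1 ≤ r j ∧ r j ≤ D.q := fun j h1 h2 =>
    (D.stepLength_spec hp h1 h2).2
  have hm0 : m 0 = r 1 := if_pos rfl
  have hmq : ∀ j, 1 ≤ j → j ≤ n → m j = D.q := fun j h1 h2 => by
    simp only [m]; rw [if_neg (by omega), if_pos h2]
  have hmz : ∀ j, n < j → m j = 0 := fun j h1 => by
    simp only [m]; rw [if_neg (by omega), if_neg (by omega)]
  have ht : ∀ j, j + 1 ≤ n → t j = r (j + 1) := fun j h1 => if_pos h1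
  have htz : ∀ j, n ≤ j → t j = 0 := fun j h1 => if_neg (by omega)
  have hmle : ∀ j, m j ≤ D.q := by
    intro j
    have := hr1 1 le_rfl (by omega)
    simp only [m]
    split_ifs <;> omega
  choose Y N hN hinj using fun j => D.exists_isUniserial (p (j + 1)) (hmle j)
  have hd : ∀ j, ∃ f : Y (j + 1) →ₗ[D.Alg] Y j,
      LinearMap.ker f = N (j + 1) (m (j + 1) - t j) ∧ LinearMap.range f = N j (t j) := by
    intro j
    obtain ⟨P, hP, K, hK⟩ := D.exists_injective_isUniserial (p (j + 1))
    by_cases hj : j + 1 ≤ n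
    · have h1 := hr1 (j + 1) (by omega) (by omega)
      refine (hN (j + 1)).exists_hom (hN j) hK (Nat.pos_of_neZero D.q) ?_ ?_ fun _ s => ?_
      · rw [ht j hj, hmq _ (by omega) hj]; exact h1.2
      · rw [ht j hj]
        rcases Nat.eq_zero_or_pos j with rfl | hpos
        · exact hm0.ge
        · rw [hmq _ hpos (by omega)]; exact h1.2
      · rw [ht j hj, hmq _ (by omega) hj]
        exact D.residue_sub_colength hp (j := j + 1) (by omega) (by omega) s
    · have h1 := htz j (by omega)
      exact (hN (j + 1)).exists_hom (hN j) hK (Nat.pos_of_neZero D.q) (by omega) (by omega)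
        fun h => absurd h (by omega)
  choose d hker hrange using hd
  have hzero : ∀ j, ModuleCat.ofHom (d (j + 1)) ≫ ModuleCat.ofHom (d j) = 0 := by
    intro j
    rw [← ModuleCat.ofHom_comp, ModuleCat.hom_ext_iff]
    change (d j).comp (d (j + 1)) = 0
    rw [← LinearMap.range_le_ker_iff, hrange, hker]
    refine (hN (j + 1)).mono ?_ (Nat.sub_le _ _)
    by_cases hj : j + 2 ≤ n
    · rw [ht _ hj, ht _ (by omega), hmq _ (by omega) (by omega)]
      exact D.stepLength_succ_le hp (j := j + 1) (by omega) (by change j + 1 ≤ n; omega)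
    · rw [htz _ (by omega)]; omega
  let X : ChainComplex (ModuleCat.{u} D.Alg) ℕ :=
    ChainComplex.of Y (fun j => ModuleCat.ofHom (d j)) hzero
  have hXd : ∀ j, (X.d (j + 1) j).hom = d j := by
    intro j
    have : X.d (j + 1) j = ModuleCat.ofHom (d j) :=
      ChainComplex.of_d (X := Y) (fun j => ModuleCat.ofHom (d j)) j
    rw [this]
    rfl
  have hstart : p (n + 1) = w := hp.start _ (by omega)
  have hrn : r (n + 1) = 1 := by
    have hlen := (D.stepLength_spec hp (j := n + 1) (by omega) le_rfl).1
    rw [hstart, hp.start _ (by omega), ← hr] at hlen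
    simpa [hn] using hlen
  have hstep : ∀ j, 1 ≤ j → j ≤ n → IsStep D.T π X j (N j (r (j + 1))) := by
    intro j h1 h2
    have h3 := hr1 (j + 1) (by omega) (by omega)
    have h4 := hN j
    rw [hmq j h1 h2] at h4
    refine ⟨?_, h4.isEssential h3.1 h3.2, ?_⟩
    · have := hinj j (hmq j h1 h2)
      exact Module.injective_object_of_injective_module D.Alg (Y j)
    · have h5 : LinearMap.ker (X.d j (j - 1)).hom = N j (D.q - r j) := by
        obtain ⟨i, rfl⟩ : ∃ i, j = i + 1 := ⟨j - 1, by omega⟩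
        change LinearMap.ker (X.d (i + 1) i).hom = _
        rw [hXd, hker, hmq _ h1 h2, ht _ h2]
      rw [h5]
      exact D.isGreatest_of_isUniserial hp h1 h2 h4
  refine ⟨X, ?_, ?_, ?_, ?_, ?_⟩
  · intro j hj
    have h1 := hN j
    rw [hmz j hj] at h1
    have : Subsingleton (Y j) := by
      rw [← Submodule.subsingleton_iff D.Alg, ← subsingleton_iff_bot_eq_top, ← h1.top, h1.bot]
    exact ModuleCat.isZero_of_subsingleton (Y j)
  · intro h0
    have hn0 : n = 0 := h0
    have h1 := hN 0
    have h2 : r 1 = 1 := by rw [hn0] at hrn; exact hrn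
    have h3 : p (0 + 1) = w := by rw [hn0] at hstart; exact hstart
    rw [hm0, h2, h3] at h1
    obtain ⟨g⟩ := h1.equiv_one Nat.zero_lt_one
    exact ⟨((LinearEquiv.ofTop _ h1.top).symm.trans g).toModuleIso⟩
  · intro hpos
    have h1 := hstep n hpos le_rfl
    rw [hrn] at h1
    obtain ⟨g⟩ := (hN n).equiv_one (by rw [hmq n hpos le_rfl]; exact Nat.pos_of_neZero D.q)
    rw [hstart] at g
    exact ⟨N n 1, ⟨g⟩, h1⟩
  · intro j h1 h2
    have h3 := hstep j h1 h2.le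
    have h4 : LinearMap.range (X.d (j + 1) j).hom = N j (r (j + 1)) := by
      rw [hXd, hrange, ht j h2]
    rw [h4]
    exact h3
  · intro hpos
    rw [← LinearMap.range_eq_top, hXd, hrange, ht 0 hpos, zero_add, ← hm0]
    exact (hN 0).top

theorem exists_walk (π : Fin e → ℕ) (w : ℤ) : ∃ p, IsWalk (lift π) w p :=
  exists_isWalk (Nat.pos_of_neZero e) (fun z t => by simp only [lift, residue_periodic]) w

/-! ### Cohomologically closed sets -/

/-- The right-hand side does not involve `D`, so closedness passes from one choice of ℓ, a, E, k to
every other. The extra factor T_i in the starting degree is harmless. -/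
theorem cohomologicallyClosed_iff (π : Fin e → ℕ) (I : Finset (Fin e)) :
    D.CohomologicallyClosed π I ↔ ∀ w p, IsWalk (lift π) w p → ∀ j, 1 ≤ j → j ≤ lift π w →
      ∀ z, p j < z → z < p (j + 2) → residue e z ∈ I → residue e w ∈ I := by
  constructor
  · intro h w p hp j hj hjn z hz hz' hzI
    obtain ⟨X, hX⟩ := D.exists_output hp
    exact h _ X hX j hj hjn _ hzI
      ((D.output_isCompositionFactor_iff hp hX hj hjn _).2 (Or.inl ⟨z, hz, hz', rfl⟩))
  · intro h i X hX j hj hjn x hx hfac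
    obtain ⟨p, hp⟩ := exists_walk π ((i : ℕ) : ℤ)
    have hi := residue_coe i
    rw [← hi] at hX hjn ⊢
    rcases (D.output_isCompositionFactor_iff hp hX hj hjn _).1 hfac with ⟨z, h1, h2, rfl⟩ | ⟨-, rfl⟩
    · exact h _ p hp j hj hjn z h1 h2 hx
    · exact hx

/-- The socle label is that of p 1, and the length depends only on p 1, p 2 and the parity of the
perversity. -/
theorem output_zero_equiv {π π' : Fin e → ℕ} {w w' : ℤ} {p p' : ℕ → ℤ}
    (hp : IsWalk (lift π) w p) (hp' : IsWalk (lift π') w' p')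
    {X X' : ChainComplex (ModuleCat.{u} D.Alg) ℕ} (hX : D.Output π (residue e w) X)
    (hX' : D.Output π' (residue e w') X') (hpar : Even (lift π w) ↔ Even (lift π' w'))
    (h1 : p 1 = p' 1) (h2 : p 2 = p' 2) : Nonempty (X.X 0 ≅ X'.X 0) := by
  obtain ⟨K, hK⟩ := D.output_zero_isUniserial hp hX
  obtain ⟨K', hK'⟩ := D.output_zero_isUniserial hp' hX'
  obtain ⟨P, hP, L, hL⟩ := D.exists_injective_isUniserial (p 1)
  have hlen : stepLength D.q (lift π) w p 1 = stepLength D.q (lift π') w' p' 1 := by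
    simp only [stepLength, Nat.add_sub_cancel, hpar, h1, h2, Nat.reduceAdd]
  rw [← hlen, ← h1] at hK'
  obtain ⟨g⟩ := hK.nonempty_equiv hK' hL (Nat.pos_of_neZero D.q)
  exact ⟨g.toModuleIso⟩

end Datum

/-! ### The cyclic permutation -/

theorem finRotate_val_of_lt {n : ℕ} (a : Fin n) (h : (a : ℕ) + 1 < n) :
    (finRotate n a : ℕ) = a + 1 := by
  obtain ⟨m, rfl⟩ := Nat.exists_eq_succ_of_ne_zero (a.pos).ne'
  exact congrArg Fin.val (finRotate_of_lt (k := a) (by omega))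

theorem finRotate_val_of_eq {n : ℕ} (a : Fin n) (h : (a : ℕ) + 1 = n) :
    (finRotate n a : ℕ) = 0 := by
  obtain ⟨m, rfl⟩ := Nat.exists_eq_succ_of_ne_zero (a.pos).ne'
  obtain rfl : a = Fin.last m := Fin.ext (by simpa using h)
  exact congrArg Fin.val finRotate_last

theorem cyclePerm_of_notMem {e : ℕ} {I : Finset (Fin e)} {x : Fin e} (hx : x ∉ I) :
    cyclePerm I x = x :=
  Equiv.Perm.ofSubtype_apply_of_not_mem _ hx

theorem cyclePerm_orderIso {e : ℕ} (I : Finset (Fin e)) (a : Fin I.card) :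
    cyclePerm I (I.orderIsoOfFin rfl a) = I.orderIsoOfFin rfl (finRotate I.card a) := by
  rw [cyclePerm, Equiv.Perm.ofSubtype_apply_coe]
  simp [Equiv.permCongr_apply]

theorem cyclePerm_mem_iff {e : ℕ} {I : Finset (Fin e)} {x : Fin e} :
    cyclePerm I x ∈ I ↔ x ∈ I := by
  by_cases hx : x ∈ I
  · obtain ⟨a, ha⟩ := (I.orderIsoOfFin rfl).surjective ⟨x, hx⟩
    have : x = I.orderIsoOfFin rfl a := by rw [ha]
    rw [this, cyclePerm_orderIso]
    simp
  · rw [cyclePerm_of_notMem hx]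

/-- The elements of the integer line with label in `I`. -/
def labelSet {e : ℕ} [NeZero e] (I : Finset (Fin e)) : Set ℤ := {z | residue e z ∈ I}

theorem cyclePerm_adj {e : ℕ} [NeZero e] {I : Finset (Fin e)} {f g : ℤ}
    (h : Adj (labelSet I) f g) : cyclePerm I (residue e f) = residue e g := by
  have he : (0 : ℤ) < e := by exact_mod_cast Nat.pos_of_neZero e
  obtain ⟨a, ha⟩ := (I.orderIsoOfFin rfl).surjective ⟨_, h.left⟩
  have hfa : residue e f = I.orderIsoOfFin rfl a := by rw [ha]
  rw [hfa, cyclePerm_orderIso]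
  set o := I.orderIsoOfFin rfl with ho
  set t := f / e with htdef
  have hf : f = ((o a : Fin e) : ℕ) + t * e := by
    rw [← hfa, residue_val, mul_comm]
    exact (Int.emod_add_mul_ediv f e).symm
  have hres : ∀ (b : Fin I.card) (s : ℤ), residue e (((o b : Fin e) : ℕ) + s * e) = o b := by
    intro b s
    rw [Datum.residue_periodic, residue_coe]
  suffices H : ∃ s : ℤ, Adj (labelSet I) f (((o (finRotate _ a) : Fin e) : ℕ) + s * e) by
    obtain ⟨s, hs⟩ := H
    rw [h.right_unique hs, hres]
  have hmem : ∀ (b : Fin I.card) (s : ℤ), ((o b : Fin e) : ℕ) + s * e ∈ labelSet I := by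
    intro b s
    change residue e _ ∈ I
    rw [hres]
    exact (o b).2
  have hlt_e : ∀ b, (((o b : Fin e) : ℕ) : ℤ) < e := fun b => by exact_mod_cast (o b : Fin e).2
  have hform : ∀ z ∈ labelSet I, ∃ b, z = ((o b : Fin e) : ℕ) + (z / e) * e := by
    intro z hz
    obtain ⟨b, hb⟩ := o.surjective ⟨_, hz⟩
    refine ⟨b, ?_⟩
    rw [hb, residue_val, mul_comm]
    exact (Int.emod_add_mul_ediv z e).symm
  have hmono : ∀ b c : Fin I.card, ((o b : Fin e) : ℕ) < ((o c : Fin e) : ℕ) ↔ b < c := by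
    intro b c
    rw [← o.lt_iff_lt]
    rfl
  have hcard : 0 < I.card := a.pos
  have hblock : ∀ (b : Fin I.card) (s t : ℤ), t * e ≤ ((o b : Fin e) : ℕ) + s * e → t ≤ s := by
    intro b s t h1
    by_contra! h2
    have := hlt_e b
    nlinarith
  have hblock' : ∀ (b : Fin I.card) (s t : ℤ), ((o b : Fin e) : ℕ) + s * e < (t + 1) * e →
      s ≤ t := by
    intro b s t h1
    by_contra! h2
    nlinarith
  -- Inside a block of length e the successor is the next element of I; after the last element it is
  -- the first one, in the following block.
  by_cases hlast : (a : ℕ) + 1 < I.card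
  · have hrot := finRotate_val_of_lt a hlast
    refine ⟨t, h.left, hmem _ _, ?_, fun z h1 h2 hz => ?_⟩
    · have := (hmono a (finRotate _ a)).2 (by rw [Fin.lt_def]; omega)
      omega
    · obtain ⟨b, hb⟩ := hform z hz
      have h3 := hlt_e (finRotate _ a)
      have h4 : z / e = t := le_antisymm
        (hblock' b _ _ (by rw [← hb, add_mul, one_mul]; omega))
        (hblock b _ _ (by rw [← hb]; omega))
      rw [h4] at hb
      have h5 := (hmono a b).1 (by omega)
      have h6 := (hmono b (finRotate _ a)).1 (by omega)
      rw [Fin.lt_def] at h5 h6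
      omega
  · have hrot := finRotate_val_of_eq a (by omega)
    have hte : (t + 1) * e = t * e + e := by ring
    have hte' : (t + 1 + 1) * e = t * e + e + e := by ring
    refine ⟨t + 1, h.left, hmem _ _, ?_, fun z h1 h2 hz => ?_⟩
    · have := hlt_e a
      omega
    · obtain ⟨b, hb⟩ := hform z hz
      have h3 := hlt_e (finRotate _ a)
      have h4 : z / e ≤ t + 1 := hblock' b _ _ (by rw [← hb]; omega)
      have h5 : t ≤ z / e := hblock b _ _ (by rw [← hb]; omega)
      rcases (show z / e = t ∨ z / e = t + 1 by omega) with h6 | h6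
      · rw [h6] at hb
        have h5 := (hmono a b).1 (by omega)
        rw [Fin.lt_def] at h5
        omega
      · rw [h6] at hb
        have h5 := (hmono b (finRotate _ a)).1 (by omega)
        rw [Fin.lt_def] at h5
        omega

/-! ### From closed sets of labels to shifts on the line. -/

section Shift

variable {e : ℕ} [NeZero e] {π π' : Fin e → ℕ} {I : Finset (Fin e)}

theorem isShift_lift (D : Datum.{u} e) (hI : D.CohomologicallyClosed π I)
    (hoff : ∀ i ∉ I, π' i = π i) (hon : ∀ i ∈ I, π' (cyclePerm I i) = π i + 2) :
    IsShift e (Datum.lift π) (Datum.lift π') (labelSet I) where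
  pos := Nat.pos_of_neZero e
  periodic z t := by simp only [Datum.lift, Datum.residue_periodic]
  mem_iff z t := by
    change residue e _ ∈ I ↔ residue e _ ∈ I
    rw [Datum.residue_periodic]
  off z hz := hoff _ hz
  on f g h := by
    change π' (residue e g) = π (residue e f) + 2
    rw [← cyclePerm_adj h]
    exact hon _ h.left
  closed := (D.cohomologicallyClosed_iff π I).1 hI

theorem exists_corresponding_walks
    (hS : IsShift e (Datum.lift π) (Datum.lift π') (labelSet I)) (i : Fin e) :
    ∃ (w w' : ℤ) (p p' : ℕ → ℤ), residue e w = i ∧ residue e w' = cyclePerm I i ∧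
      IsWalk (Datum.lift π) w p ∧ IsWalk (Datum.lift π') w' p' ∧ p 1 = p' 1 ∧ p 2 = p' 2 ∧
      Datum.lift π w ≡ Datum.lift π' w' [MOD 2] ∧
      ∀ x, walkSum (Datum.lift π') w' p' {z | residue e z = cyclePerm I x} =
        walkSum (Datum.lift π) w p {z | residue e z = x} := by
  obtain ⟨p, hp⟩ := Datum.exists_walk π ((i : ℕ) : ℤ)
  have hi := residue_coe i
  have hsub : ∀ x ∈ I, {z | residue e z = x} ⊆ labelSet I := by
    rintro x hx z rfl
    exact hx
  by_cases hiI : i ∈ I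
  · have hmem : ((i : ℕ) : ℤ) ∈ labelSet I := by
      change residue e _ ∈ I
      rwa [hi]
    obtain ⟨w', hw⟩ := hS.exists_adj_right hmem
    obtain ⟨p', hp'⟩ := Datum.exists_walk π' w'
    refine ⟨_, w', p, p', hi, by rw [← cyclePerm_adj hw, hi], hp, hp',
      (hS.eq_of_le_two hw hp hp' le_rfl (by omega)).symm,
      (hS.eq_of_le_two hw hp hp' (by omega) le_rfl).symm, ?_, fun x => ?_⟩
    · rw [hS.on _ _ hw]
      exact (Nat.add_mod_right _ 2).symm
    · by_cases hx : x ∈ I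
      · refine hS.walkSum_of_subset hw hp hp' (hsub x hx) (hsub _ (cyclePerm_mem_iff.2 hx))
          fun f g hfg => ?_
        change residue e f = x ↔ residue e g = cyclePerm I x
        rw [← cyclePerm_adj hfg, EmbeddingLike.apply_eq_iff_eq]
      · rw [cyclePerm_of_notMem hx]
        refine hS.walkSum_of_disjoint hw hp hp' ?_
        rintro z rfl
        exact hx
  · have hmem : ((i : ℕ) : ℤ) ∉ labelSet I := by
      change residue e _ ∉ I
      rwa [hi]
    have hp' := hS.isWalk_of_notMem hmem hp
    refine ⟨_, _, p, p, hi, by rw [hi, cyclePerm_of_notMem hiI], hp, hp', rfl, rfl, ?_, fun x => ?_⟩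
    · rw [hS.off _ hmem]
    · rw [hS.walkSum_of_notMem hmem hp hp']
      by_cases hx : x ∈ I
      · rw [hS.walkSum_eq_zero hmem hp (hsub x hx),
          hS.walkSum_eq_zero hmem hp (hsub _ (cyclePerm_mem_iff.2 hx))]
      · rw [cyclePerm_of_notMem hx]

/-- A walk starting off S is the same for both functions, so the old closedness applies to it. -/
theorem closed_of_isShift (hS : IsShift e (Datum.lift π) (Datum.lift π') (labelSet I))
    (v : ℤ) (p' : ℕ → ℤ) (hp' : IsWalk (Datum.lift π') v p') (j : ℕ) (hj : 1 ≤ j)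
    (hjn : j ≤ Datum.lift π' v) (z : ℤ) (hz : p' j < z) (hz' : z < p' (j + 2))
    (hzI : residue e z ∈ I) : residue e v ∈ I := by
  by_contra hv
  obtain ⟨p, hp⟩ := Datum.exists_walk π v
  have hu := (hS.isWalk_of_notMem (w := v) hv hp).unique hp'
  rw [← hu j hj] at hz
  rw [← hu (j + 2) (by omega)] at hz'
  rw [hS.off v hv] at hjn
  exact hv (hS.closed v p hp j hj hjn z hz hz' hzI)

theorem closed_map_of_isShift (hS : IsShift e (Datum.lift π) (Datum.lift π') (labelSet I))
    {I₁ : Finset (Fin e)} (hI₁ : I₁ ⊆ I)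
    (hcl : ∀ w p, IsWalk (Datum.lift π) w p → ∀ j, 1 ≤ j → j ≤ Datum.lift π w →
      ∀ z, p j < z → z < p (j + 2) → residue e z ∈ I₁ → residue e w ∈ I₁)
    (v : ℤ) (p' : ℕ → ℤ) (hp' : IsWalk (Datum.lift π') v p') (j : ℕ) (hj : 1 ≤ j)
    (hjn : j ≤ Datum.lift π' v) (z : ℤ) (hz : p' j < z) (hz' : z < p' (j + 2))
    (hzI : residue e z ∈ I₁.map (cyclePerm I).toEmbedding) :
    residue e v ∈ I₁.map (cyclePerm I).toEmbedding := by
  have hmap : ∀ x, cyclePerm I x ∈ I₁.map (cyclePerm I).toEmbedding ↔ x ∈ I₁ := fun x =>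
    Finset.mem_map' (cyclePerm I).toEmbedding
  have hzS : z ∈ labelSet I := by
    obtain ⟨x, hx, hxz⟩ := Finset.mem_map.1 hzI
    change residue e z ∈ I
    rw [← hxz]
    exact cyclePerm_mem_iff.2 (hI₁ hx)
  have hvS : v ∈ labelSet I := closed_of_isShift hS v p' hp' j hj hjn z hz hz' hzS
  obtain ⟨w, hw⟩ := hS.exists_adj_left hvS
  obtain ⟨p, hp⟩ := Datum.exists_walk π w
  rw [← cyclePerm_adj hw, hmap]
  -- Steps 1 and 2 of p' skip no element of S; every other skip comes from step j - 2 of the old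
  -- walk.
  have hj2 : 2 < j := by
    by_contra! hj2
    exact hS.notMem_of_le_two hw hp hp' hj hj2 hz hz' hzS
  obtain ⟨i, rfl⟩ : ∃ i, j = i + 2 := ⟨j - 2, by omega⟩
  rw [hS.on _ _ hw] at hjn
  obtain ⟨f, hf, h1, h2⟩ := hS.passes_backward hw hp hp' (j := i) (by omega) (by omega) hzS hz hz'
  refine hcl w p hp i (by omega) (by omega) f h1 h2 ?_
  rwa [← hmap, cyclePerm_adj hf]

end Shift

end PerverseAlgorithm

theorem mainTheorem8 (e : ℕ) (D₀ D D' : PerverseAlgorithm.Datum.{u} e)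
    (π π' : Fin e → ℕ) (I I₁ : Finset (Fin e)) (hI₁ : I₁ ⊆ I)
    (hI_closed : D₀.CohomologicallyClosed π I)
    (hI₁_closed : D₀.CohomologicallyClosed π I₁)
    (hπ'_off : ∀ i ∉ I, π' i = π i)
    (hπ'_on : ∀ i ∈ I, π' (PerverseAlgorithm.cyclePerm I i) = π i + 2) :
    PerverseAlgorithm.AlgorithmicallyEquivalentVia D D' π π' (PerverseAlgorithm.cyclePerm I) ∧
    D'.CohomologicallyClosed π' I ∧
    D'.CohomologicallyClosed π' (I₁.map (PerverseAlgorithm.cyclePerm I).toEmbedding) ∧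
    ∀ (σ : Equiv.Perm (Fin e)) (C : Fin e → ModuleCat.{u} D.Alg),
      D.DegreeZeroTerms π σ C →
        D.DegreeZeroTerms π' (σ.trans (PerverseAlgorithm.cyclePerm I)) C := by
  have := D₀.neZero
  -- This statement about functions on ℤ is free of the choices in `D₀`, which is why `D` and `D'`
  -- may be arbitrary.
  have hS := PerverseAlgorithm.isShift_lift D₀ hI_closed hπ'_off hπ'_on
  refine ⟨fun i => ?_, ?_, ?_, fun σ C hC s => ?_⟩
  · obtain ⟨w, w', p, p', rfl, hw', hp, hp', h1, h2, hmod, hsum⟩ :=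
      PerverseAlgorithm.exists_corresponding_walks hS i
    rw [← hw']
    refine ⟨hmod, D.exists_output hp, D'.exists_output hp', fun X X' hX hX' => ⟨fun x => ?_,
      _, _, D.output_hasSocleTop hp hX, ?_⟩⟩
    · rw [D.output_altSum hp hX, D'.output_altSum hp' hX', hsum, hw']
      simp only [EmbeddingLike.apply_eq_iff_eq]
    · rw [h1, h2]
      exact D'.output_hasSocleTop hp' hX'
  · rw [D'.cohomologicallyClosed_iff]
    exact PerverseAlgorithm.closed_of_isShift hS
  · rw [D'.cohomologicallyClosed_iff]
    exact PerverseAlgorithm.closed_map_of_isShift hS hI₁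
      ((D₀.cohomologicallyClosed_iff π I₁).1 hI₁_closed)
  · obtain ⟨X, hX, ⟨g⟩⟩ := hC s
    obtain ⟨w, w', p, p', hw, hw', hp, hp', h1, h2, hmod, -⟩ :=
      PerverseAlgorithm.exists_corresponding_walks hS (σ s)
    obtain ⟨X', hX'⟩ := D.exists_output hp'
    rw [← hw] at hX
    have hpar : Even (PerverseAlgorithm.Datum.lift π w) ↔
        Even (PerverseAlgorithm.Datum.lift π' w') := by
      rw [Nat.even_iff, Nat.even_iff, hmod]
    obtain ⟨g'⟩ := D.output_zero_equiv hp hp' hX hX' hpar h1 h2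
    refine ⟨X', ?_, ⟨g'.symm.trans g⟩⟩
    rw [Equiv.trans_apply, ← hw']
    exact hX'
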